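/- Let $q$ be a fixed prime power. For each $n$, let $v_1,v_2,\ldots$ be independent uniformly random vectors in $\mathbb{F}_q^n$, let $A_m=[v_1,\ldots,v_m]$, and let $M[A_m]$ be the matroid on the column indices $\{1,\dots,m\}$ represented by $A_m$ (a set of indices is independent if and only if the corresponding family of columns is linearly independent). A $k$-circuit is a minimal dependent set with exactly $k$ elements. Let $\tau_{k\text{-circ}}$ be the smallest $m$ such that $M[A_m]$ has a $k$-circuit ($\infty$ if there is none). For $0<a\le 1$ put $$g_a(y)=y\log y+a\log(q-1)-a\log a-(y-a)\log(y-a)-\log q,\qquad y\ge a,$$ where $0\log 0=0$. For random variables $X_n$ and nonnegative reals $x_n$, write $X_n=\Theta_p(x_n)$ if $$\lim_{\varepsilon\to0^+}\limsup_{n\to\infty}\bigl(\mathbb P(X_n<\varepsilon x_n)+\mathbb P(X_n>\varepsilon^{-1}x_n)\bigr)=0,$$ and say that a.a.s. $X_n\sim x_n$ if for every $\varepsilon>0$, $\mathbb P\bigl((1-\varepsilon)x_n\le X_n\le(1+\varepsilon)x_n\bigr)\to1$ as $n\to\infty$. Then the following hold as $n\to\infty$. (a) For every fixed integer $k\ge1$,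 $\tau_{k\text{-circ}}=\Theta_p(q^{n/k})$. (b) If $k=k(n)\to\infty$ and $k=o(n)$, then a.a.s. $\tau_{k\text{-circ}}\sim \frac{1}{e(q-1)}\,k\,q^{n/k}$. (c) For every fixed $0<a\le1$, the function $g_a$ has a unique root $b=b(a)$ in $[a,\infty)$; and if $k=k(n)\sim an$ with $k\le n+1$ for all sufficiently large $n$, then a.a.s. $\tau_{k\text{-circ}}\sim bn$. -/

import Mathlib

open MeasureTheory ProbabilityTheory Filter Topology Asymptotics

/-- The matroid represented by a matrix `A` over a field: its ground set is the set of all column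
indices, and a set of column indices is independent when the corresponding family of columns
is linearly independent (so two indices with equal columns are dependent). -/
def matrixMatroid {F R E : Type*} [Field F] [Finite E] (A : Matrix R E F) : Matroid E :=
  (IndepMatroid.ofFinite (E := Set.univ) Set.finite_univ
    (fun S : Set E => LinearIndepOn F (fun j => A.col j) S)
    (linearIndepOn_empty F _)
    (fun _ _ hJ hIJ => hJ.mono hIJ)
    (by
      intro I J hI hJ hlt
      by_contra hcon
      push Not at hcon
      have hsub : (fun j => A.col j) '' J ⊆
          (Submodule.span F ((fun j => A.col j) '' I) : Set (R → F)) := by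
        rintro _ ⟨e, he, rfl⟩
        by_contra hns
        have heI : e ∉ I := fun h => hns (Submodule.subset_span ⟨e, h, rfl⟩)
        exact hcon e he heI (hI.insert hns)
      have hle := Submodule.span_le.2 hsub
      have : Module.Finite F (Submodule.span F ((fun j => A.col j) '' I)) :=
        FiniteDimensional.span_of_finite F (Set.toFinite _)
      have h1 := Submodule.finrank_mono hle
      have hr : ∀ K : Set E, LinearIndepOn F (fun j => A.col j) K →
          Module.finrank F (Submodule.span F ((fun j => A.col j) '' K)) = K.ncard := by
        intro K hK
        have : Fintype K := Fintype.ofFinite K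
        have := finrank_span_eq_card (R := F) (b := fun j : K => A.col j) hK
        rw [Set.image_eq_range, this, ← Nat.card_eq_fintype_card, Nat.card_coe_set_eq]
      rw [hr I hI, hr J hJ] at h1
      omega)
    (fun _ _ => Set.subset_univ _)).matroid

/-- The matrix `A_m = [v₁, …, v_m]` formed by the first `m` vectors of a sequence
(the sequence is indexed from `0`). -/
def firstColumns {F : Type*} {n : ℕ} (v : ℕ → Fin n → F) (m : ℕ) : Matrix (Fin n) (Fin m) F :=
  Matrix.of fun i j => v j i

/-- `M` has a circuit of length `k`. -/
def HasCircuitOfLength {E : Type*} (M : Matroid E) (k : ℕ) : Prop :=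
  ∃ C : Set E, M.IsCircuit C ∧ C.encard = k

/-- The smallest `m` such that the matroid represented by the first `m` vectors of the sequence
has a circuit of length `k`; it is `⊤` if there is no such `m`. -/
noncomputable def circuitTime {F : Type*} [Field F] {n : ℕ} (v : ℕ → Fin n → F) (k : ℕ) : ℕ∞ :=
  sInf ((fun m : ℕ => (m : ℕ∞)) '' {m | HasCircuitOfLength (matrixMatroid (firstColumns v m)) k})

/-- The extended real number underlying an extended natural number. -/
noncomputable def enatToEReal (t : ℕ∞) : EReal := ((t : ENNReal) : EReal)

/-- `X_n = Θ_p(x_n)`: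
`lim_{ε → 0+} limsup_{n → ∞} (P(X_n < ε x_n) + P(X_n > ε⁻¹ x_n)) = 0`. -/
def IsThetaInProbability {Ω : ℕ → Type*} [∀ n, MeasurableSpace (Ω n)] (P : ∀ n, Measure (Ω n))
    (X : ∀ n, Ω n → ℕ∞) (x : ℕ → ℝ) : Prop :=
  Tendsto (fun ε : ℝ => limsup (fun n =>
      P n {ω | enatToEReal (X n ω) < ((ε * x n : ℝ) : EReal)} +
      P n {ω | ((ε⁻¹ * x n : ℝ) : EReal) < enatToEReal (X n ω)}) atTop)
    (𝓝[>] 0) (𝓝 0)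

/-- Asymptotically almost surely `X_n ∼ x_n` (for nonnegative `x_n`): for every `ε > 0`, with
probability tending to `1`, `(1 - ε) x_n ≤ X_n ≤ (1 + ε) x_n`. -/
def IsAasEquivalent {Ω : ℕ → Type*} [∀ n, MeasurableSpace (Ω n)] (P : ∀ n, Measure (Ω n))
    (X : ∀ n, Ω n → ℕ∞) (x : ℕ → ℝ) : Prop :=
  ∀ ε : ℝ, 0 < ε → Tendsto (fun n =>
      P n {ω | (((1 - ε) * x n : ℝ) : EReal) ≤ enatToEReal (X n ω) ∧
        enatToEReal (X n ω) ≤ (((1 + ε) * x n : ℝ) : EReal)})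
    atTop (𝓝 1)

/-- The function `g_a(y)`, of interest for `y ≥ a > 0`; the value of `0 log 0` is `0`. -/
noncomputable def circuitRate (q a y : ℝ) : ℝ :=
  y * Real.log y + a * Real.log (q - 1) - a * Real.log a - (y - a) * Real.log (y - a) - Real.log q

/-! The proof is the first and second moment method applied to the number of $k$-subsets of the
first $m$ columns that are circuits. Circuits survive when columns are appended, so both tails of
the circuit time are events about $m=\lfloor y\rfloor$ columns, and only upper bounds on their
probabilities are needed.

A $k$-set is a circuit exactly when $k-1$ of its vectors are independent and the last is a
combination of them with all coefficients nonzero. Its probability $p$ is therefore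
$(q-1)^{k-1}/q^n$ times the probability that $k-1$ vectors are independent, a factor lying in
$[1/4,1]$ when $k\le n+1$. Hence the mean is $\mu=\binom mk (q-1)^{k-1}/q^n$ up to a factor 4, and
$\mu\to0$ excludes circuits.

For the second moment, distinct $k$-sets $S,T$ interact only because each circuit forces $S\cap T$
to be independent: the joint probability is $p^2$ divided by the probability of that independence
(`uniformProb_isCircuitOn_and`), which is at most $p^2(1+4q^{|S\cap T|-n})$. Averaging $q^{|S\cap
T|}$ over $T$ gives at most $(1+(q-1)\theta)^k$ when $k\le\theta m$ (`sum_pow_card_inter_le`).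
Chebyshev's inequality then bounds the probability of no circuit by $4/\mu+4(1+(q-1)\theta)^k/q^n$
(`uniformProb_not_exists_isCircuitOn_le`). For fixed $\theta<1$ and $k\le n+1$ the second term
vanishes, so circuits appear once $\mu\to\infty$.

It remains to locate where $\mu$ passes from small to large. For fixed $k$ this is at $m$ of order
$q^{n/k}$. For $1\ll k\ll n$, Stirling's formula puts it at $kq^{n/k}/(e(q-1))$, where changing $m$
by a factor $1\pm\varepsilon$ changes $\mu$ exponentially in $k$. For $k\sim an$ and $m\sim yn$,
$\mu=e^{n(g_a(y)+o(1))}$, and $g_a$ increases strictly from a negative value, so the threshold is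
its root. -/

/-! ### Uniform probability on a finite type -/

open Classical in
/-- The probability of a predicate under the uniform distribution on a finite type. -/
noncomputable def uniformProb {W : Type*} [Fintype W] (Q : W → Prop) : ℝ :=
  (∑ w : W, if Q w then (1 : ℝ) else 0) / Fintype.card W

lemma uniformProb_nonneg {W : Type*} [Fintype W] (Q : W → Prop) : 0 ≤ uniformProb Q := by
  classical
  unfold uniformProb
  refine div_nonneg (Finset.sum_nonneg fun w _ => ?_) (by positivity)
  split_ifs <;> norm_num

lemma uniformProb_mono {W : Type*} [Fintype W] {Q R : W → Prop} (h : ∀ w, Q w → R w) :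
    uniformProb Q ≤ uniformProb R := by
  classical
  unfold uniformProb
  gcongr with w _
  by_cases hq : Q w
  · simp [hq, h w hq]
  · simp only [hq, if_false]
    split_ifs <;> norm_num

lemma uniformProb_exists_mem_le {W ι : Type*} [Fintype W] (I : Finset ι) (A : ι → W → Prop) :
    uniformProb (fun w => ∃ i ∈ I, A i w) ≤ ∑ i ∈ I, uniformProb (A i) := by
  classical
  unfold uniformProb
  rw [← Finset.sum_div, Finset.sum_comm]
  gcongr with w _
  split_ifs with h
  · obtain ⟨i, hi, hA⟩ := h
    calc (1 : ℝ) = if A i w then (1 : ℝ) else 0 := by simp [hA]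
      _ ≤ _ := Finset.single_le_sum (f := fun i => if A i w then (1 : ℝ) else 0)
          (fun j _ => by split_ifs <;> norm_num) hi
  · exact Finset.sum_nonneg fun j _ => by split_ifs <;> norm_num

/-- Chebyshev's inequality for the number of events that occur. -/
lemma uniformProb_forall_not_mul_sq_le {W ι : Type*} [Fintype W] [Nonempty W] (I : Finset ι)
    (A : ι → W → Prop) :
    uniformProb (fun w => ∀ i ∈ I, ¬ A i w) * (∑ i ∈ I, uniformProb (A i)) ^ 2 ≤
      ∑ i ∈ I, ∑ j ∈ I, uniformProb (fun w => A i w ∧ A j w) -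
        (∑ i ∈ I, uniformProb (A i)) ^ 2 := by
  classical
  set X : W → ℝ := fun w => ∑ i ∈ I, if A i w then (1 : ℝ) else 0 with hX
  set c : ℝ := (Fintype.card W : ℝ) with hc
  have hcpos : 0 < c := by simp only [hc]; exact_mod_cast Fintype.card_pos
  set M := ∑ i ∈ I, uniformProb (A i) with hM
  have h1 : ∑ w, X w = M * c := by
    simp only [hX, hM, uniformProb]
    rw [Finset.sum_comm, ← Finset.sum_div, div_mul_cancel₀ _ hcpos.ne']
  have h2 : ∑ w, X w ^ 2 = (∑ i ∈ I, ∑ j ∈ I, uniformProb (fun w => A i w ∧ A j w)) * c := by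
    have : ∀ w, X w ^ 2 = ∑ i ∈ I, ∑ j ∈ I, if A i w ∧ A j w then (1 : ℝ) else 0 := by
      intro w
      simp only [hX]
      rw [sq, Finset.sum_mul_sum]
      refine Finset.sum_congr rfl fun i _ => Finset.sum_congr rfl fun j _ => ?_
      by_cases hi : A i w <;> by_cases hj : A j w <;> simp [hi, hj]
    simp only [this, uniformProb]
    rw [Finset.sum_comm]
    simp_rw [← Finset.sum_div]
    rw [div_mul_cancel₀ _ hcpos.ne']
    refine Finset.sum_congr rfl fun i _ => ?_
    rw [Finset.sum_comm]
    exact Finset.sum_congr rfl fun j _ => Finset.sum_congr rfl fun w _ => by congr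
  -- When no event occurs the count is 0, so its squared deviation from the mean is exactly `M ^ 2`.
  have h3 : (∑ w : W, if ∀ i ∈ I, ¬ A i w then (1 : ℝ) else 0) * M ^ 2 ≤
      ∑ w, (X w - M) ^ 2 := by
    rw [Finset.sum_mul]
    refine Finset.sum_le_sum fun w _ => ?_
    split_ifs with h
    · have : X w = 0 := Finset.sum_eq_zero fun i hi => by simp [h i hi]
      simp [this]
    · simp only [zero_mul]; positivity
  have h4 : ∑ w, (X w - M) ^ 2 = ∑ w, X w ^ 2 - c * M ^ 2 := by
    have : ∀ w, (X w - M) ^ 2 = X w ^ 2 - 2 * M * X w + M ^ 2 := fun w => by ring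
    simp only [this, Finset.sum_add_distrib, Finset.sum_sub_distrib, ← Finset.mul_sum, h1]
    simp [← hc]
    ring
  rw [h4, h2] at h3
  simp only [uniformProb]
  rw [← hc, div_mul_eq_mul_div, div_le_iff₀ hcpos]
  refine le_trans (le_of_eq ?_) (h3.trans (le_of_eq ?_))
  · congr! 4
  · simp only [uniformProb, ← hc]
    ring

/-- Resampling one coordinate: if the event `R` does not depend on the coordinate `e`, and whenever
`R` holds exactly `K` values of this coordinate make `Q` true, then `R ∧ Q` has probability
`K / |V|` times that of `R`. -/
lemma uniformProb_and_of_update {E V : Type*} [Fintype E] [DecidableEq E] [Fintype V] [Nonempty V]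
    (e : E) (R Q : (E → V) → Prop) (K : ℝ)
    (hR : ∀ w x, R (Function.update w e x) ↔ R w)
    (hK : ∀ w, R w → (Nat.card {x | Q (Function.update w e x)} : ℝ) = K) :
    uniformProb (fun w => R w ∧ Q w) = uniformProb R * (K / Fintype.card V) := by
  classical
  have hV : (0 : ℝ) < Fintype.card V := by exact_mod_cast Fintype.card_pos
  have hW : (0 : ℝ) < Fintype.card (E → V) := by exact_mod_cast Fintype.card_pos
  set f : (E → V) → ℝ := fun w => if R w ∧ Q w then (1 : ℝ) else 0 with hf
  -- Exchanging the coordinate `w e` with the fresh value `x` is an involution of the pairs `(w,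
  -- x)`.
  have key : ∑ p : (E → V) × V, f (Function.update p.1 e p.2) = ∑ p : (E → V) × V, f p.1 := by
    refine Finset.sum_nbij' (fun p => (Function.update p.1 e p.2, p.1 e))
      (fun p => (Function.update p.1 e p.2, p.1 e)) ?_ ?_ ?_ ?_ ?_ <;> simp
  rw [Fintype.sum_prod_type, Fintype.sum_prod_type] at key
  have hr : ∀ w, ∑ _x : V, f w = Fintype.card V * f w := by intro w; simp
  have hl : ∀ w, ∑ x : V, f (Function.update w e x) = (if R w then (1 : ℝ) else 0) * K := by
    intro w
    by_cases h : R w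
    · simp only [hf, hR, h, true_and, if_true, one_mul, ← hK w h]
      rw [Finset.sum_boole, Nat.card_eq_fintype_card, Fintype.card_subtype]
      simp
    · simp [hf, hR, h]
  simp only [hl, hr, ← Finset.sum_mul, ← Finset.mul_sum] at key
  unfold uniformProb
  rw [div_mul_div_comm, div_eq_div_iff hW.ne' (mul_pos hW hV).ne', key]
  simp only [hf]
  ring_nf

/-! ### Circuits of random families of vectors -/

/-- The vectors `w i`, `i ∈ S`, are linearly dependent, but become independent when any one of
them is left out. -/
def IsCircuitOn (F : Type*) {E V : Type*} [Field F] [AddCommGroup V] [Module F V]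
    (w : E → V) (S : Finset E) : Prop :=
  ¬ LinearIndepOn F w (S : Set E) ∧ ∀ e ∈ S, LinearIndepOn F w ((S : Set E) \ {e})

lemma update_image_of_notMem {E V : Type*} [DecidableEq E] {w : E → V} {J : Set E} {e : E} (he : e ∉ J) (x : V) :
    Function.update w e x '' J = w '' J := by
  refine Set.image_congr fun i hi => ?_
  rw [Function.update_of_ne]
  rintro rfl
  exact he hi

section Counting

variable {F E V : Type*} [Field F] [AddCommGroup V] [Module F V]

lemma IsCircuitOn.linearIndepOn_of_subset {w : E → V} {S J : Finset E} (h : IsCircuitOn F w S)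
    (hJ : J ⊆ S) {e : E} (heS : e ∈ S) (heJ : e ∉ J) : LinearIndepOn F w (J : Set E) := by
  refine (h.2 e heS).mono fun i hi => ⟨hJ hi, ?_⟩
  rintro rfl
  exact heJ hi

lemma linearIndepOn_update [DecidableEq E] {w : E → V} {J : Set E} {e : E} (he : e ∉ J) (x : V) :
    LinearIndepOn F (Function.update w e x) J ↔ LinearIndepOn F w J := by
  refine linearIndepOn_congr fun i hi => ?_
  rw [Function.update_of_ne]
  rintro rfl
  exact he hi

lemma isCircuitOn_update [DecidableEq E] {w : E → V} {S : Finset E} {e : E} (he : e ∉ S) (x : V) :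
    IsCircuitOn F (Function.update w e x) S ↔ IsCircuitOn F w S := by
  unfold IsCircuitOn
  rw [linearIndepOn_update (by simpa using he)]
  refine and_congr_right fun _ => forall₂_congr fun i _ => linearIndepOn_update ?_ x
  exact fun h => he h.1

lemma linearIndepOn_update_insert [DecidableEq E] {w : E → V} {J : Set E} {e : E} (he : e ∉ J)
    (hJ : LinearIndepOn F w J) (x : V) :
    LinearIndepOn F (Function.update w e x) (insert e J) ↔ x ∉ Submodule.span F (w '' J) := by
  rw [linearIndepOn_insert he, linearIndepOn_update he, update_image_of_notMem he]
  simp [hJ]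

lemma card_linearIndepOn_update_insert [Fintype F] [Fintype V] [DecidableEq E]
    {w : E → V} {J : Finset E} {e : E} (he : e ∉ J) (hJ : LinearIndepOn F w (J : Set E)) :
    (Nat.card {x | LinearIndepOn F (Function.update w e x) ((insert e J : Finset E) : Set E)} : ℝ) =
      Fintype.card V - (Fintype.card F : ℝ) ^ J.card := by
  classical
  simp only [Finset.coe_insert, linearIndepOn_update_insert (by simpa using he) hJ]
  have h1 : Nat.card (Submodule.span F (w '' (J : Set E))) = Fintype.card F ^ J.card := by
    have h := finrank_span_eq_card (R := F) (b := fun i : (J : Set E) => w i) hJ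
    rw [← Set.image_eq_range] at h
    rw [Module.natCard_eq_pow_finrank (K := F), h, Nat.card_eq_fintype_card]
    simp
  have h2 := Set.ncard_add_ncard_compl (Submodule.span F (w '' (J : Set E)) : Set V)
  have h3 : {x | x ∉ Submodule.span F (w '' (J : Set E))} =
      (Submodule.span F (w '' (J : Set E)) : Set V)ᶜ := rfl
  rw [Nat.card_coe_set_eq, h3]
  rw [← Nat.card_coe_set_eq (Submodule.span F (w '' (J : Set E)) : Set V)] at h2
  change Nat.card (Submodule.span F (w '' (J : Set E))) + _ = _ at h2
  rw [h1, Nat.card_eq_fintype_card] at h2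
  rw [eq_sub_iff_add_eq, ← h2]
  push_cast
  ring

/-- Over an independent family the coefficients of `x` are unique, and dropping `i` restores
independence precisely when the coefficient at `i` is nonzero. -/
lemma isCircuitOn_update_insert_iff [DecidableEq E] {w : E → V} {J : Finset E} {e : E}
    (he : e ∉ J) (hJ : LinearIndepOn F w (J : Set E)) (x : V) :
    IsCircuitOn F (Function.update w e x) (insert e J) ↔
      ∃ c : J → Fˣ, ∑ i, (c i : F) • w i = x := by
  classical
  have he' : e ∉ (J : Set E) := by simpa using he
  have hdiff : ∀ i ∈ J, ((insert e J : Finset E) : Set E) \ {i} = insert e ((J : Set E) \ {i}) := by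
    intro i hi
    have : e ≠ i := fun h => he (h ▸ hi)
    ext j
    simp only [Finset.coe_insert, Set.mem_sdiff, Set.mem_insert_iff, Finset.mem_coe,
      Set.mem_singleton_iff]
    constructor
    · rintro ⟨rfl | h, h'⟩ <;> tauto
    · rintro (rfl | h) <;> tauto
  have hi' : ∀ i ∈ J, (LinearIndepOn F (Function.update w e x)
      (((insert e J : Finset E) : Set E) \ {i}) ↔
        x ∉ Submodule.span F (w '' ((J : Set E) \ {i}))) := by
    intro i hi
    rw [hdiff i hi]
    exact linearIndepOn_update_insert (fun h => he' h.1) (hJ.mono Set.sdiff_subset) x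
  have h0 : IsCircuitOn F (Function.update w e x) (insert e J) ↔
      x ∈ Submodule.span F (w '' (J : Set E)) ∧
        ∀ i ∈ J, x ∉ Submodule.span F (w '' ((J : Set E) \ {i})) := by
    unfold IsCircuitOn
    rw [Finset.coe_insert, linearIndepOn_update_insert he' hJ, not_not, ← Finset.coe_insert]
    refine and_congr_right fun _ => ?_
    rw [Finset.forall_mem_insert]
    have : ((insert e J : Finset E) : Set E) \ {e} = J := by
      rw [Finset.coe_insert]; simp [he]
    rw [this, linearIndepOn_update he']
    simp only [hJ, true_and]
    exact forall₂_congr hi'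
  rw [h0]
  have hspan : ∀ (c : J → F) (i : J), c i = 0 →
      ∑ j, c j • w j ∈ Submodule.span F (w '' ((J : Set E) \ {(i : E)})) := by
    intro c i hc
    refine Submodule.sum_mem _ fun j _ => ?_
    by_cases hji : j = i
    · simp [hji, hc]
    · exact Submodule.smul_mem _ _ (Submodule.subset_span
        ⟨j, ⟨j.2, fun h => hji (Subtype.ext h)⟩, rfl⟩)
  constructor
  · rintro ⟨h1, h2⟩
    rw [Set.image_eq_range] at h1
    obtain ⟨c, hc⟩ := (Submodule.mem_span_range_iff_exists_fun F).1 h1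
    have hne : ∀ i : J, c i ≠ 0 := by
      intro i hi
      apply h2 i i.2
      rw [← hc]
      exact hspan c i hi
    exact ⟨fun i => Units.mk0 (c i) (hne i), hc⟩
  · rintro ⟨c, rfl⟩
    constructor
    · exact Submodule.sum_mem _ fun j _ => Submodule.smul_mem _ _ (Submodule.subset_span
        ⟨j, j.2, rfl⟩)
    · intro i hi hmem
      set i' : J := ⟨i, hi⟩
      -- Subtracting the terms other than `i` leaves a nonzero multiple of `w i` in the span of the
      -- others, against independence.
      have h3 : w i ∈ Submodule.span F (w '' ((J : Set E) \ {i})) := by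
        have h4 := hspan (fun j => if j = i' then 0 else (c j : F)) i' (by simp)
        have h5 := Submodule.sub_mem _ hmem h4
        rw [← Finset.sum_sub_distrib, Finset.sum_eq_single i'] at h5
        · simp only [if_true, zero_smul, sub_zero] at h5
          have := Submodule.smul_mem _ ((c i')⁻¹ : Fˣ).val h5
          rwa [smul_smul, Units.inv_mul, one_smul] at this
        · intro j _ hj
          simp [hj]
        · simp
      have h6 := hJ
      rw [show (J : Set E) = insert i ((J : Set E) \ {i}) by simp [hi],
        linearIndepOn_insert (by simp)] at h6
      exact h6.2 h3

lemma card_isCircuitOn_update_insert [Fintype F] [Fintype V] [DecidableEq E]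
    {w : E → V} {J : Finset E} {e : E} (he : e ∉ J) (hJ : LinearIndepOn F w (J : Set E)) :
    (Nat.card {x | IsCircuitOn F (Function.update w e x) (insert e J)} : ℝ) =
      ((Fintype.card F : ℝ) - 1) ^ J.card := by
  classical
  simp only [isCircuitOn_update_insert_iff he hJ]
  have hinj : Function.Injective (fun c : J → Fˣ => ∑ i, (c i : F) • w i) := by
    intro c d hcd
    have h := Fintype.linearIndependent_iffₛ.1 hJ (fun i => (c i : F)) (fun i => (d i : F)) hcd
    funext i
    exact Units.ext (h i)
  have : Nat.card {x | ∃ c : J → Fˣ, ∑ i, (c i : F) • w i = x} = Nat.card (J → Fˣ) :=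
    Nat.card_congr (Equiv.ofInjective _ hinj).symm
  rw [this, Nat.card_eq_fintype_card, Fintype.card_fun, Fintype.card_units, Fintype.card_coe]
  push_cast [Nat.cast_sub Fintype.card_pos]
  simp

variable [Fintype F] [Fintype V] [Fintype E] [DecidableEq E]

lemma uniformProb_and_linearIndepOn_insert {R : (E → V) → Prop} {J : Finset E} {e : E}
    (he : e ∉ J) (hR : ∀ w x, R (Function.update w e x) ↔ R w)
    (hRJ : ∀ w, R w → LinearIndepOn F w (J : Set E)) :
    uniformProb (fun w => R w ∧ LinearIndepOn F w ((insert e J : Finset E) : Set E)) =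
      uniformProb R * (1 - (Fintype.card F : ℝ) ^ J.card / Fintype.card V) := by
  have hV : (Fintype.card V : ℝ) ≠ 0 := Nat.cast_ne_zero.2 Fintype.card_ne_zero
  have h := uniformProb_and_of_update e R
    (fun w => LinearIndepOn F w ((insert e J : Finset E) : Set E)) _ hR
    (fun w hw => card_linearIndepOn_update_insert he (hRJ w hw))
  rw [h, sub_div, div_self hV]

lemma uniformProb_and_isCircuitOn_insert {R : (E → V) → Prop} {J : Finset E} {e : E}
    (he : e ∉ J) (hR : ∀ w x, R (Function.update w e x) ↔ R w)
    (hRJ : ∀ w, R w → LinearIndepOn F w (J : Set E)) :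
    uniformProb (fun w => R w ∧ IsCircuitOn F w (insert e J)) =
      uniformProb R * (((Fintype.card F : ℝ) - 1) ^ J.card / Fintype.card V) :=
  uniformProb_and_of_update e R _ _ hR
    (fun w hw => card_isCircuitOn_update_insert he (hRJ w hw))

/-- The vectors of `D` are exposed one at a time, each having to avoid the span of its predecessors.
The event `R` carries what is already known about the other coordinates. -/
lemma uniformProb_and_linearIndepOn_union {R : (E → V) → Prop} {J : Finset E} (D : Finset E)
    (hD : Disjoint J D) (hR : ∀ e ∈ D, ∀ w x, R (Function.update w e x) ↔ R w)
    (hRJ : ∀ w, R w → LinearIndepOn F w (J : Set E)) :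
    uniformProb (fun w => R w ∧ LinearIndepOn F w ((J ∪ D : Finset E) : Set E)) =
      uniformProb R *
        ∏ i ∈ Finset.range D.card, (1 - (Fintype.card F : ℝ) ^ (J.card + i) / Fintype.card V) := by
  induction D using Finset.induction_on with
  | empty =>
    simp only [Finset.union_empty, Finset.card_empty, Finset.range_zero, Finset.prod_empty, mul_one]
    congr 1
    funext w
    exact propext (and_iff_left_of_imp (hRJ w))
  | insert e D heD ih =>
    rw [Finset.disjoint_insert_right] at hD
    have ih' := ih hD.2 (fun e' he' => hR e' (Finset.mem_insert_of_mem he'))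
    have heJD : e ∉ J ∪ D := by simp [hD.1, heD]
    have h1 := uniformProb_and_linearIndepOn_insert
      (R := fun w => R w ∧ LinearIndepOn F w ((J ∪ D : Finset E) : Set E)) heJD
      (fun w x => by
        rw [hR e (Finset.mem_insert_self _ _), linearIndepOn_update (by exact_mod_cast heJD)])
      (fun w hw => hw.2)
    rw [ih', Finset.card_union_of_disjoint hD.2] at h1
    rw [Finset.card_insert_of_notMem heD, Finset.prod_range_succ, ← mul_assoc, ← h1]
    congr 1
    funext w
    rw [Finset.union_insert]
    refine propext ⟨fun h => ⟨⟨h.1, h.2.mono ?_⟩, h.2⟩, fun h => ⟨h.1.1, h.2⟩⟩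
    exact_mod_cast Finset.subset_insert _ _

variable (F E V)

/-- The probability that `j` uniformly random vectors of `V` are linearly independent. -/
noncomputable def indepProb (j : ℕ) : ℝ :=
  ∏ i ∈ Finset.range j, (1 - (Fintype.card F : ℝ) ^ i / Fintype.card V)

/-- The probability that `k` uniformly random vectors of `V` form a circuit. -/
noncomputable def circuitProb (k : ℕ) : ℝ :=
  ((Fintype.card F : ℝ) - 1) ^ (k - 1) / Fintype.card V * indepProb F V (k - 1)

variable {F E V}

lemma uniformProb_isCircuitOn {S : Finset E} (hS : S.Nonempty) :
    uniformProb (fun w : E → V => IsCircuitOn F w S) = circuitProb F V S.card := by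
  obtain ⟨e, he⟩ := hS
  set T := S.erase e with hT
  have heT : e ∉ T := by simp [hT]
  have hST : insert e T = S := Finset.insert_erase he
  have hTc : T.card = S.card - 1 := Finset.card_erase_of_mem he
  have h1 := uniformProb_and_linearIndepOn_union (F := F) (V := V) (R := fun _ : E → V => True)
    (J := ∅) T (by simp) (by simp) (by simp)
  have h2 := uniformProb_and_isCircuitOn_insert (F := F) (V := V)
    (R := fun w : E → V => LinearIndepOn F w (T : Set E)) heT
    (fun w x => linearIndepOn_update (by exact_mod_cast heT) x) (fun w hw => hw)
  have h3 : uniformProb (fun _ : E → V => True) = 1 := by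
    simp only [uniformProb, if_true, Finset.sum_const, nsmul_eq_mul, mul_one]
    exact div_self (by exact_mod_cast Fintype.card_ne_zero)
  simp only [true_and, Finset.empty_union, Finset.card_empty, zero_add, h3, one_mul] at h1
  rw [h1, hST, hTc] at h2
  rw [circuitProb, indepProb, mul_comm, ← h2]
  congr 1
  funext w
  refine propext ⟨fun h => ⟨?_, h⟩, fun h => h.2⟩
  exact h.linearIndepOn_of_subset (Finset.erase_subset _ _) he heT

/-- The joint probability of two distinct circuits of the same size depends only on the size of
their intersection. -/
lemma uniformProb_isCircuitOn_and {S T : Finset E} (hcard : T.card = S.card) (hne : S ≠ T) :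
    uniformProb (fun w : E → V => IsCircuitOn F w S ∧ IsCircuitOn F w T) *
      indepProb F V (S ∩ T).card = circuitProb F V S.card ^ 2 := by
  have hTS : ¬ T ⊆ S := fun h => hne (Finset.eq_of_subset_of_card_le h hcard.ge).symm
  have hSS : ¬ S ⊆ T := fun h => hne (Finset.eq_of_subset_of_card_le h hcard.le)
  -- The vector at `e` is exposed last and closes the circuit `T`; the index `f` shows that `S ∩ T`
  -- is a proper subset of the circuit `S`, hence independent.
  obtain ⟨e, heT, heS⟩ := Finset.not_subset.1 hTS
  obtain ⟨f, hfS, hfT⟩ := Finset.not_subset.1 hSS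
  set J := S ∩ T with hJ
  set D := (T \ S).erase e with hD
  have heJD : e ∉ J ∪ D := by simp [hJ, hD, heS]
  have hins : insert e (J ∪ D) = T := by
    rw [← Finset.union_insert, hD, Finset.insert_erase (by simp [heT, heS]), hJ,
      Finset.inter_comm, Finset.union_comm, Finset.sdiff_union_inter]
  have hJD : Disjoint J D := by
    rw [Finset.disjoint_left]
    intro i hi hi'
    simp only [hJ, hD, Finset.mem_inter, Finset.mem_erase, Finset.mem_sdiff] at hi hi'
    exact hi'.2.2 hi.1
  have hDS : ∀ i ∈ D, i ∉ S := fun i hi => by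
    simp only [hD, Finset.mem_erase, Finset.mem_sdiff] at hi
    exact hi.2.2
  have hcardT : T.card = J.card + D.card + 1 := by
    rw [← hins, Finset.card_insert_of_notMem heJD, Finset.card_union_of_disjoint hJD]
  have h1 := uniformProb_and_linearIndepOn_union (F := F) (V := V)
    (R := fun w : E → V => IsCircuitOn F w S) (J := J) D hJD
    (fun i hi w x => isCircuitOn_update (hDS i hi) x)
    (fun w hw => hw.linearIndepOn_of_subset Finset.inter_subset_left hfS
      (fun h => hfT (Finset.mem_inter.1 h).2))
  have h2 := uniformProb_and_isCircuitOn_insert (F := F) (V := V)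
    (R := fun w : E → V => IsCircuitOn F w S ∧ LinearIndepOn F w ((J ∪ D : Finset E) : Set E)) heJD
    (fun w x => by rw [isCircuitOn_update heS, linearIndepOn_update (by exact_mod_cast heJD)])
    (fun w hw => hw.2)
  rw [h1, hins, uniformProb_isCircuitOn ⟨f, hfS⟩, Finset.card_union_of_disjoint hJD] at h2
  have h3 : (fun w : E → V => IsCircuitOn F w S ∧ IsCircuitOn F w T) = fun w =>
      (IsCircuitOn F w S ∧ LinearIndepOn F w ((J ∪ D : Finset E) : Set E)) ∧
        IsCircuitOn F w T := by
    funext w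
    refine propext ⟨fun h => ⟨⟨h.1, ?_⟩, h.2⟩, fun h => ⟨h.1.1, h.2⟩⟩
    exact h.2.linearIndepOn_of_subset (hins ▸ Finset.subset_insert _ _) heT heJD
  -- Given the circuit `S`, the factors for `S ∩ T` are not paid again; multiplying by them restores
  -- a full circuit probability for `T`, with no division by a quantity that may vanish.
  have h4 : indepProb F V (J.card + D.card) = indepProb F V J.card *
      ∏ i ∈ Finset.range D.card, (1 - (Fintype.card F : ℝ) ^ (J.card + i) / Fintype.card V) :=
    Finset.prod_range_add _ _ _
  rw [h3, h2, sq]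
  nth_rw 3 [circuitProb]
  rw [show S.card - 1 = J.card + D.card by omega, h4]
  ring

end Counting

/-! ### The second moment of the number of circuits -/

lemma card_filter_powersetCard_superset {E : Type*} [Fintype E] [DecidableEq E] (I : Finset E)
    {k : ℕ} (hk : I.card ≤ k) :
    ((Finset.univ.powersetCard k).filter (fun T : Finset E => I ⊆ T)).card =
      (Fintype.card E - I.card).choose (k - I.card) := by
  rw [← Finset.card_compl, ← Finset.card_powersetCard]
  refine Finset.card_nbij' (fun T => T \ I) (fun T => T ∪ I) ?_ ?_ ?_ ?_
  · intro T hT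
    simp only [Finset.coe_filter, Finset.mem_powersetCard, Set.mem_ofPred_eq, Finset.subset_univ,
      true_and, Finset.mem_coe] at hT ⊢
    exact ⟨fun x hx => by simpa using (Finset.mem_sdiff.1 hx).2,
      by rw [Finset.card_sdiff_of_subset hT.2, hT.1]⟩
  · intro T hT
    simp only [Finset.coe_filter, Finset.mem_powersetCard, Set.mem_ofPred_eq, Finset.subset_univ,
      true_and, Finset.mem_coe] at hT ⊢
    have hdisj : Disjoint T I := by
      rw [Finset.disjoint_left]
      intro x hx
      simpa using hT.1 hx
    exact ⟨by rw [Finset.card_union_of_disjoint hdisj, hT.2]; omega, Finset.subset_union_right⟩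
  · intro T hT
    simp only [Finset.coe_filter, Set.mem_ofPred_eq] at hT
    exact Finset.sdiff_union_of_subset hT.2
  · intro T hT
    simp only [Finset.mem_powersetCard, Finset.mem_coe] at hT
    have hdisj : Disjoint T I := by
      rw [Finset.disjoint_left]
      intro x hx
      simpa using hT.1 hx
    exact Finset.union_sdiff_cancel_right hdisj

/-- Each step multiplies by `(k - i) / (m - i)`, which is at most `θ` because `k ≤ θ * m` and `θ ≤
1`. -/
lemma choose_sub_sub_le {m k : ℕ} {θ : ℝ} (hθ : θ ≤ 1) (hkm : k ≤ m) (hk : (k : ℝ) ≤ θ * m)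
    {i : ℕ} (hi : i ≤ k) : (((m - i).choose (k - i) : ℕ) : ℝ) ≤ θ ^ i * m.choose k := by
  induction i with
  | zero => simp
  | succ i ih =>
    have ih' := ih (by omega)
    have hθ0 : 0 ≤ θ := by
      by_contra h
      push Not at h
      have : (0 : ℝ) < m := by exact_mod_cast (by omega : 0 < m)
      nlinarith [(Nat.cast_nonneg k : (0 : ℝ) ≤ k)]
    obtain ⟨a, ha⟩ : ∃ a, m - i = a + 1 := ⟨m - i - 1, by omega⟩
    obtain ⟨b, hb⟩ : ∃ b, k - i = b + 1 := ⟨k - i - 1, by omega⟩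
    rw [show m - (i + 1) = a by omega, show k - (i + 1) = b by omega]
    rw [ha, hb] at ih'
    have h1 : ((a : ℝ) + 1) * a.choose b = (a + 1).choose (b + 1) * ((b : ℝ) + 1) := by
      exact_mod_cast Nat.add_one_mul_choose_eq a b
    have hm : (m : ℝ) = a + 1 + i := by exact_mod_cast (by omega : m = a + 1 + i)
    have hk' : (k : ℝ) = b + 1 + i := by exact_mod_cast (by omega : k = b + 1 + i)
    have h2 : (b : ℝ) + 1 ≤ θ * (a + 1) := by
      rw [hm, hk'] at hk
      nlinarith [(Nat.cast_nonneg i : (0 : ℝ) ≤ i)]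
    have ha0 : (0 : ℝ) < a + 1 := by positivity
    have h3 : ((a : ℝ) + 1) * a.choose b ≤ (a + 1) * (θ * (a + 1).choose (b + 1)) := by
      rw [h1]
      nlinarith [(Nat.cast_nonneg ((a + 1).choose (b + 1)) : (0 : ℝ) ≤ _)]
    calc (a.choose b : ℝ) ≤ θ * (a + 1).choose (b + 1) := le_of_mul_le_mul_left h3 ha0
      _ ≤ θ * (θ ^ i * m.choose k) := by gcongr
      _ = θ ^ (i + 1) * m.choose k := by ring

lemma sum_pow_card_inter_le {E : Type*} [Fintype E] [DecidableEq E] {k : ℕ} {θ z : ℝ} (hθ : θ ≤ 1)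
    (hkE : k ≤ Fintype.card E) (hk : (k : ℝ) ≤ θ * Fintype.card E) (hz : 1 ≤ z) {S : Finset E}
    (hS : S.card = k) :
    ∑ T ∈ (Finset.univ : Finset E).powersetCard k, z ^ (S ∩ T).card ≤
      (Fintype.card E).choose k * (1 + (z - 1) * θ) ^ k := by
  -- Writing `z = (z - 1) + 1` and expanding over subsets reduces the sum to counting the sets `T`
  -- that contain a given `I ⊆ S`.
  have h1 : ∀ T : Finset E, z ^ (S ∩ T).card =
      ∑ I ∈ S.powerset, if I ⊆ T then (z - 1) ^ I.card else 0 := by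
    intro T
    rw [← Finset.sum_filter]
    have : S.powerset.filter (fun I => I ⊆ T) = (S ∩ T).powerset := by
      ext I
      simp only [Finset.mem_filter, Finset.mem_powerset, Finset.subset_inter_iff]
    rw [this]
    have h := Finset.sum_pow_mul_eq_add_pow (z - 1) 1 (S ∩ T)
    simpa using h.symm
  simp only [h1]
  rw [Finset.sum_comm]
  have h2 := Finset.sum_pow_mul_eq_add_pow ((z - 1) * θ) 1 S
  rw [add_comm (1 : ℝ), ← hS, ← h2, hS, Finset.mul_sum]
  refine Finset.sum_le_sum fun I hI => ?_
  have hIk : I.card ≤ k := hS ▸ Finset.card_le_card (Finset.mem_powerset.1 hI)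
  rw [← Finset.sum_filter, Finset.sum_const, nsmul_eq_mul,
    card_filter_powersetCard_superset I hIk, one_pow, mul_one, mul_pow]
  have hz' : 0 ≤ (z - 1) ^ I.card := pow_nonneg (by linarith) _
  calc _ ≤ (θ ^ I.card * (Fintype.card E).choose k) * (z - 1) ^ I.card :=
        mul_le_mul_of_nonneg_right (choose_sub_sub_le hθ hkE hk hIk) hz'
    _ = _ := by ring

/-! ### Estimates for the independence and circuit probabilities. -/

section Bounds

variable {F V : Type*} [Field F] [Fintype F] [Fintype V]

lemma two_le_card_field (F : Type*) [Field F] [Fintype F] : (2 : ℝ) ≤ Fintype.card F := by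
  exact_mod_cast Fintype.one_lt_card (α := F)

lemma one_sub_le_indepProb {n j : ℕ} (hV : (Fintype.card V : ℝ) = (Fintype.card F : ℝ) ^ n)
    (hj : j ≤ n) :
    1 - (Fintype.card F : ℝ) ^ j / (Fintype.card F : ℝ) ^ n ≤ indepProb F V j := by
  have hq := two_le_card_field F
  set q : ℝ := (Fintype.card F : ℝ) with hqdef
  induction j with
  | zero => simp [indepProb]; positivity
  | succ j ih =>
    have ih' := ih (by omega)
    have : indepProb F V (j + 1) = indepProb F V j * (1 - q ^ j / q ^ n) := by
      rw [indepProb, indepProb, Finset.prod_range_succ, hV]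
    rw [this]
    set x := q ^ j / q ^ n with hx
    have hx0 : 0 ≤ x := by positivity
    have hx1 : q ^ (j + 1) / q ^ n = q * x := by rw [hx]; ring
    have hx2 : q ^ (j + 1) / q ^ n ≤ 1 :=
      div_le_one_of_le₀ (pow_le_pow_right₀ (by linarith) hj) (by positivity)
    rw [hx1] at hx2 ⊢
    have hx3 : x ≤ 1 := by nlinarith
    -- This is `(1 - x) ^ 2 ≥ 1 - 2 * x ≥ 1 - q * x`.
    nlinarith [mul_le_mul_of_nonneg_right ih' (by linarith : 0 ≤ 1 - x)]

/-- The bound `one_sub_le_indepProb` is vacuous at `j = n`. Splitting off the last factor leaves two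
numbers that are each at least `1 / 2`. -/
lemma one_fourth_le_indepProb {n j : ℕ} (hV : (Fintype.card V : ℝ) = (Fintype.card F : ℝ) ^ n)
    (hj : j ≤ n) : 1 / 4 ≤ indepProb F V j := by
  have hq := two_le_card_field F
  have hhalf : ∀ i, i + 1 ≤ n →
      (Fintype.card F : ℝ) ^ i / (Fintype.card F : ℝ) ^ n ≤ 1 / 2 := by
    intro i hi
    rw [div_le_div_iff₀ (by positivity) (by norm_num), one_mul]
    calc (Fintype.card F : ℝ) ^ i * 2 ≤ (Fintype.card F : ℝ) ^ i * Fintype.card F := by gcongr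
      _ = (Fintype.card F : ℝ) ^ (i + 1) := by ring
      _ ≤ _ := pow_le_pow_right₀ (by linarith) hi
  rcases j with _ | j
  · simp [indepProb]; norm_num
  · have h1 := one_sub_le_indepProb hV (by omega : j ≤ n)
    have h2 := hhalf j hj
    have : indepProb F V (j + 1) = indepProb F V j *
        (1 - (Fintype.card F : ℝ) ^ j / (Fintype.card F : ℝ) ^ n) := by
      rw [indepProb, indepProb, Finset.prod_range_succ, hV]
    rw [this]
    nlinarith

lemma indepProb_le_one {n : ℕ} (hV : (Fintype.card V : ℝ) = (Fintype.card F : ℝ) ^ n) (j : ℕ) :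
    indepProb F V j ≤ 1 := by
  have hq := two_le_card_field F
  rcases lt_or_ge n j with h | h
  · have : indepProb F V j = 0 := by
      refine Finset.prod_eq_zero (Finset.mem_range.2 h) ?_
      rw [hV, div_self (by positivity), sub_self]
    rw [this]
    norm_num
  · refine Finset.prod_le_one (fun i hi => ?_) (fun i hi => ?_)
    · rw [hV, sub_nonneg]
      exact div_le_one_of_le₀ (pow_le_pow_right₀ (by linarith)
        ((Finset.mem_range.1 hi).le.trans h)) (by positivity)
    · rw [sub_le_self_iff]
      positivity

lemma circuitProb_le {n : ℕ} (hV : (Fintype.card V : ℝ) = (Fintype.card F : ℝ) ^ n) (k : ℕ) :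
    circuitProb F V k ≤ ((Fintype.card F : ℝ) - 1) ^ (k - 1) / (Fintype.card F : ℝ) ^ n := by
  have hq := two_le_card_field F
  rw [circuitProb, hV]
  refine mul_le_of_le_one_right (div_nonneg (pow_nonneg (by linarith) _) (by positivity))
    (indepProb_le_one hV _)

lemma le_circuitProb {n k : ℕ} (hV : (Fintype.card V : ℝ) = (Fintype.card F : ℝ) ^ n)
    (hk : k ≤ n + 1) :
    ((Fintype.card F : ℝ) - 1) ^ (k - 1) / (Fintype.card F : ℝ) ^ n / 4 ≤ circuitProb F V k := by
  have hq := two_le_card_field F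
  rw [circuitProb, hV, div_eq_mul_one_div _ (4 : ℝ)]
  refine mul_le_mul_of_nonneg_left (one_fourth_le_indepProb hV (by omega))
    (div_nonneg (pow_nonneg (by linarith) _) (by positivity))

end Bounds

section SecondMoment

variable {F E V : Type*} [Field F] [AddCommGroup V] [Module F V]
  [Fintype F] [Fintype V] [Fintype E] [DecidableEq E]

/-- The first moment bound. -/
lemma uniformProb_exists_isCircuitOn_le {n k : ℕ}
    (hV : (Fintype.card V : ℝ) = (Fintype.card F : ℝ) ^ n) (hk : 1 ≤ k) :
    uniformProb (fun w : E → V => ∃ S : Finset E, S.card = k ∧ IsCircuitOn F w S) ≤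
      (Fintype.card E).choose k *
        (((Fintype.card F : ℝ) - 1) ^ (k - 1) / (Fintype.card F : ℝ) ^ n) := by
  have h1 := uniformProb_exists_mem_le (Finset.univ.powersetCard k)
    (fun (S : Finset E) (w : E → V) => IsCircuitOn F w S)
  simp only [Finset.mem_powersetCard, Finset.subset_univ, true_and] at h1
  refine h1.trans ?_
  rw [Finset.sum_congr rfl (g := fun _ => circuitProb F V k)]
  · rw [Finset.sum_const, Finset.card_powersetCard, nsmul_eq_mul, Finset.card_univ]
    gcongr
    exact circuitProb_le hV k
  · intro S hS
    rw [Finset.mem_powersetCard] at hS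
    rw [uniformProb_isCircuitOn (Finset.card_pos.1 (by omega)), hS.2]

lemma uniformProb_isCircuitOn_and_le {n k : ℕ}
    (hV : (Fintype.card V : ℝ) = (Fintype.card F : ℝ) ^ n) (hk : k ≤ n + 1)
    {S T : Finset E} (hS : S.card = k) (hT : T.card = k) (hne : S ≠ T) :
    uniformProb (fun w : E → V => IsCircuitOn F w S ∧ IsCircuitOn F w T) ≤
      circuitProb F V k ^ 2 *
        (1 + 4 * ((Fintype.card F : ℝ) ^ (S ∩ T).card / (Fintype.card F : ℝ) ^ n)) := by
  have hlt : (S ∩ T).card < k := by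
    rw [← hS]
    refine Finset.card_lt_card (Finset.ssubset_iff_subset_ne.2 ⟨Finset.inter_subset_left, ?_⟩)
    intro h
    exact hne (Finset.eq_of_subset_of_card_le (Finset.inter_eq_left.1 h) (by omega))
  have h := uniformProb_isCircuitOn_and (F := F) (V := V) (hT.trans hS.symm) hne
  have h1 := one_sub_le_indepProb hV (by omega : (S ∩ T).card ≤ n)
  have h2 := one_fourth_le_indepProb hV (by omega : (S ∩ T).card ≤ n)
  have h3 := uniformProb_nonneg (fun w : E → V => IsCircuitOn F w S ∧ IsCircuitOn F w T)
  rw [hS] at h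
  rw [← h, mul_assoc]
  have hx : 0 ≤ (Fintype.card F : ℝ) ^ (S ∩ T).card / (Fintype.card F : ℝ) ^ n := by positivity
  refine le_mul_of_one_le_right h3 ?_
  -- With `x` the ratio of powers and `I` the independence probability, `I ≥ 1 - x` and `4 * I ≥ 1`
  -- give `I * (1 + 4 * x) ≥ (1 - x) + x = 1`.
  nlinarith

/-- The second moment bound. -/
lemma uniformProb_not_exists_isCircuitOn_le {n k : ℕ} {θ : ℝ}
    (hV : (Fintype.card V : ℝ) = (Fintype.card F : ℝ) ^ n) (hk : 1 ≤ k) (hkn : k ≤ n + 1)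
    (hθ : θ ≤ 1) (hkE : (k : ℝ) ≤ θ * Fintype.card E) :
    uniformProb (fun w : E → V => ¬ ∃ S : Finset E, S.card = k ∧ IsCircuitOn F w S) ≤
      4 / ((Fintype.card E).choose k *
        (((Fintype.card F : ℝ) - 1) ^ (k - 1) / (Fintype.card F : ℝ) ^ n)) +
      4 * (1 + ((Fintype.card F : ℝ) - 1) * θ) ^ k / (Fintype.card F : ℝ) ^ n := by
  have hq := two_le_card_field F
  set q : ℝ := (Fintype.card F : ℝ) with hqdef
  have hkE' : k ≤ Fintype.card E := by
    have : (k : ℝ) ≤ Fintype.card E :=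
      hkE.trans (mul_le_of_le_one_left (Nat.cast_nonneg _) hθ)
    exact_mod_cast this
  set p := circuitProb F V k with hp
  set N : ℝ := ((Fintype.card E).choose k : ℝ) with hN
  set B := (1 + (q - 1) * θ) ^ k / q ^ n with hB
  have hNpos : 0 < N := by
    rw [hN]
    exact_mod_cast Nat.choose_pos hkE'
  have hκ : 0 < (q - 1) ^ (k - 1) / q ^ n := div_pos (pow_pos (by linarith) _) (by positivity)
  have hpl : (q - 1) ^ (k - 1) / q ^ n / 4 ≤ p := le_circuitProb hV hkn
  have hppos : 0 < p := lt_of_lt_of_le (by positivity) hpl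
  have hprob : ∀ S ∈ (Finset.univ : Finset E).powersetCard k,
      uniformProb (fun w : E → V => IsCircuitOn F w S) = p := by
    intro S hS
    rw [Finset.mem_powersetCard] at hS
    rw [uniformProb_isCircuitOn (Finset.card_pos.1 (by omega)), hS.2]
  have hcheb := uniformProb_forall_not_mul_sq_le ((Finset.univ : Finset E).powersetCard k)
    (fun (S : Finset E) (w : E → V) => IsCircuitOn F w S)
  rw [Finset.sum_congr rfl hprob, Finset.sum_const, Finset.card_powersetCard, nsmul_eq_mul,
    Finset.card_univ, ← hN] at hcheb
  have hpair : ∀ S ∈ (Finset.univ : Finset E).powersetCard k,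
      ∑ T ∈ (Finset.univ : Finset E).powersetCard k,
        uniformProb (fun w : E → V => IsCircuitOn F w S ∧ IsCircuitOn F w T) ≤
      p + N * p ^ 2 + 4 * p ^ 2 * (N * B) := by
    intro S hS
    have hS' := (Finset.mem_powersetCard.1 hS).2
    have h1 : ∀ T ∈ (Finset.univ : Finset E).powersetCard k,
        uniformProb (fun w : E → V => IsCircuitOn F w S ∧ IsCircuitOn F w T) ≤
          (if S = T then p else 0) + (p ^ 2 + 4 * p ^ 2 / q ^ n * q ^ (S ∩ T).card) := by
      intro T hT
      have hT' := (Finset.mem_powersetCard.1 hT).2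
      split_ifs with hST
      · have : uniformProb (fun w : E → V => IsCircuitOn F w S ∧ IsCircuitOn F w T) ≤ p := by
          rw [← hprob S hS]
          exact uniformProb_mono fun w hw => hw.1
        have h0 : 0 ≤ p ^ 2 + 4 * p ^ 2 / q ^ n * q ^ (S ∩ T).card := by positivity
        linarith
      · rw [zero_add]
        refine (uniformProb_isCircuitOn_and_le hV hkn hS' hT' hST).trans (le_of_eq ?_)
        rw [← hqdef, ← hp]
        ring
    refine (Finset.sum_le_sum h1).trans ?_
    rw [Finset.sum_add_distrib, Finset.sum_ite_eq, if_pos hS, Finset.sum_add_distrib,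
      Finset.sum_const, Finset.card_powersetCard, nsmul_eq_mul, Finset.card_univ, ← hN,
      ← Finset.mul_sum, add_assoc]
    have h2 := sum_pow_card_inter_le hθ hkE' hkE (by linarith : 1 ≤ q) hS'
    have h3 : 0 ≤ 4 * p ^ 2 / q ^ n := by positivity
    have h4 := mul_le_mul_of_nonneg_left h2 h3
    have h5 : 4 * p ^ 2 / q ^ n * (((Fintype.card E).choose k : ℝ) * (1 + (q - 1) * θ) ^ k) =
        4 * p ^ 2 * (N * B) := by rw [hB, ← hN]; ring
    linarith
  have hsum := Finset.sum_le_sum hpair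
  rw [Finset.sum_const, Finset.card_powersetCard, nsmul_eq_mul, Finset.card_univ, ← hN] at hsum
  have hNp : 0 < N * p := by positivity
  have hfun : (fun w : E → V => ¬ ∃ S : Finset E, S.card = k ∧ IsCircuitOn F w S) =
      fun w => ∀ S ∈ (Finset.univ : Finset E).powersetCard k, ¬ IsCircuitOn F w S := by
    funext w
    simp [Finset.mem_powersetCard]
  rw [hfun]
  set P0 := uniformProb (fun w : E → V =>
    ∀ S ∈ (Finset.univ : Finset E).powersetCard k, ¬ IsCircuitOn F w S)
  -- The independent part of the pair sum cancels the squared mean, leaving the diagonal and the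
  -- overlap term.
  have hmain : P0 * (N * p) ^ 2 ≤ N * p + 4 * (N * p) ^ 2 * B := by
    have : N * (p + N * p ^ 2 + 4 * p ^ 2 * (N * B)) - (N * p) ^ 2 =
      N * p + 4 * (N * p) ^ 2 * B := by ring
    linarith
  have hdiv : P0 ≤ 1 / (N * p) + 4 * B := by
    rw [← mul_le_mul_iff_left₀ (pow_pos hNp 2)]
    refine hmain.trans (le_of_eq ?_)
    field_simp
  have h6 : 1 / (N * p) ≤ 4 / (N * ((q - 1) ^ (k - 1) / q ^ n)) := by
    rw [div_le_div_iff₀ hNp (by positivity)]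
    nlinarith
  calc P0 ≤ 1 / (N * p) + 4 * B := hdiv
    _ ≤ 4 / (N * ((q - 1) ^ (k - 1) / q ^ n)) + 4 * B := by gcongr
    _ = _ := by rw [hB, mul_div_assoc]

end SecondMoment

/-! ### The circuit time in terms of finite families -/

lemma hasCircuitOfLength_firstColumns_iff {F : Type*} [Field F] {n : ℕ} (v : ℕ → Fin n → F)
    (m k : ℕ) :
    HasCircuitOfLength (matrixMatroid (firstColumns v m)) k ↔
      ∃ S : Finset (Fin m), S.card = k ∧ IsCircuitOn F (fun j : Fin m => v j) S := by
  classical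
  have hindep : ∀ C : Set (Fin m), (matrixMatroid (firstColumns v m)).Indep C ↔
      LinearIndepOn F (fun j : Fin m => v j) C := fun C => Iff.rfl
  have hcirc : ∀ S : Finset (Fin m), (matrixMatroid (firstColumns v m)).IsCircuit (S : Set (Fin m)) ↔
      IsCircuitOn F (fun j : Fin m => v j) S := by
    intro S
    rw [Matroid.isCircuit_iff_dep_forall_sdiff_singleton_indep,
      ← Matroid.not_indep_iff (show (S : Set (Fin m)) ⊆ Set.univ from Set.subset_univ _)]
    simp only [hindep]
    rfl
  constructor
  · rintro ⟨C, hC, hk⟩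
    have hfin : (C.toFinset : Set (Fin m)) = C := Set.coe_toFinset C
    refine ⟨C.toFinset, ?_, (hcirc _).1 (hfin.symm ▸ hC)⟩
    rw [← hfin, Set.encard_coe_eq_coe_finsetCard] at hk
    exact_mod_cast hk
  · rintro ⟨S, hk, hS⟩
    exact ⟨S, (hcirc S).2 hS, by rw [Set.encard_coe_eq_coe_finsetCard, hk]⟩

lemma IsCircuitOn.map {F E E' V : Type*} [Field F] [AddCommGroup V] [Module F V] {w : E' → V}
    (f : E ↪ E') {S : Finset E} (h : IsCircuitOn F (w ∘ f) S) : IsCircuitOn F w (S.map f) := by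
  constructor
  · intro h'
    rw [Finset.coe_map] at h'
    exact h.1 (h'.comp_of_image f.injective.injOn)
  · intro e he
    obtain ⟨i, hi, rfl⟩ := Finset.mem_map.1 he
    rw [Finset.coe_map, ← Set.image_singleton, ← Set.image_sdiff f.injective]
    exact (h.2 i hi).image_of_comp

lemma enatToEReal_mono : Monotone enatToEReal := fun a b h => by
  unfold enatToEReal
  exact_mod_cast h

lemma enatToEReal_natCast (m : ℕ) : enatToEReal m = ((m : ℝ) : EReal) := by
  simp only [enatToEReal, ENat.toENNReal_coe]
  rfl

lemma exists_isCircuitOn_of_circuitTime_lt {F : Type*} [Field F] {n : ℕ} {v : ℕ → Fin n → F}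
    {k : ℕ} {y : ℝ} (h : enatToEReal (circuitTime v k) < (y : EReal)) :
    ∃ S : Finset (Fin ⌊y⌋₊), S.card = k ∧ IsCircuitOn F (fun j : Fin ⌊y⌋₊ => v j) S := by
  -- The time is an integer or `⊤`, so being below `y` forces it to be at most `⌊y⌋₊`.
  have h1 : circuitTime v k < ((⌊y⌋₊ + 1 : ℕ) : ℕ∞) := by
    by_contra hcon
    push Not at hcon
    have h2 := enatToEReal_mono hcon
    rw [enatToEReal_natCast] at h2
    have h3 := h2.trans_lt h
    rw [EReal.coe_lt_coe_iff] at h3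
    push_cast at h3
    linarith [Nat.lt_floor_add_one y]
  obtain ⟨_, ⟨m, hm, rfl⟩, hlt⟩ := sInf_lt_iff.1 h1
  have hle : m ≤ ⌊y⌋₊ := by
    have : m < ⌊y⌋₊ + 1 := Nat.cast_lt.1 (show (m : ℕ∞) < ((⌊y⌋₊ + 1 : ℕ) : ℕ∞) from hlt)
    omega
  obtain ⟨S, hS, hc⟩ := (hasCircuitOfLength_firstColumns_iff v m k).1 hm
  exact ⟨S.map (Fin.castLEEmb hle), by rw [Finset.card_map, hS],
    IsCircuitOn.map (w := fun j : Fin ⌊y⌋₊ => v j) (Fin.castLEEmb hle) hc⟩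

lemma not_exists_isCircuitOn_of_lt_circuitTime {F : Type*} [Field F] {n : ℕ} {v : ℕ → Fin n → F}
    {k : ℕ} {y : ℝ} (hy : 0 ≤ y) (h : (y : EReal) < enatToEReal (circuitTime v k)) :
    ¬ ∃ S : Finset (Fin ⌊y⌋₊), S.card = k ∧ IsCircuitOn F (fun j : Fin ⌊y⌋₊ => v j) S := by
  intro hS
  have h1 := (hasCircuitOfLength_firstColumns_iff v _ k).2 hS
  have h2 : circuitTime v k ≤ (⌊y⌋₊ : ℕ) := sInf_le ⟨_, h1, rfl⟩
  have h3 := enatToEReal_mono h2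
  rw [enatToEReal_natCast] at h3
  have h4 := h.trans_le h3
  rw [EReal.coe_lt_coe_iff] at h4
  linarith [Nat.floor_le hy]

/-! ### From the random sequence to uniform counting -/

/-- A union bound over the values of the first `m` vectors. Since only an upper bound is sought, the
event itself need not be measurable. -/
lemma measure_le_uniformProb {Ω V : Type*} [MeasurableSpace Ω] [Fintype V] [Nonempty V]
    [MeasurableSpace V] [MeasurableSingletonClass V] {P : Measure Ω} {X : ℕ → Ω → V}
    (hindep : iIndepFun X P) (hunif : ∀ i, HasLaw (X i) (uniformOn Set.univ) P) (m : ℕ)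
    (Q : (Fin m → V) → Prop) :
    P {ω | Q (fun i : Fin m => X i ω)} ≤ ENNReal.ofReal (uniformProb Q) := by
  classical
  have hcardV : (0 : ℝ) < Fintype.card V := by exact_mod_cast Fintype.card_pos
  have hone : ∀ i x, P (X i ⁻¹' {x}) = (Fintype.card V : ENNReal)⁻¹ := by
    intro i x
    have h := (hunif i).measure_eq (p := fun y => y ∈ ({x} : Set V)) (measurableSet_singleton x)
    change P (X i ⁻¹' {x}) = uniformOn Set.univ {x} at h
    rw [h, uniformOn_univ, Measure.count_singleton, one_div]
  have hpt : ∀ w : Fin m → V, P (⋂ i ∈ (Finset.univ : Finset (Fin m)), X i ⁻¹' {w i}) =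
      ((Fintype.card V : ENNReal)⁻¹) ^ m := by
    intro w
    have h := (hindep.precomp (Fin.val_injective (n := m))).measure_inter_preimage_eq_mul
      Finset.univ (sets := fun i => {w i}) (fun i _ => measurableSet_singleton _)
    refine h.trans ?_
    simp only [hone, Finset.prod_const, Finset.card_univ, Fintype.card_fin]
  have hsub : {ω | Q (fun i : Fin m => X i ω)} ⊆
      ⋃ w ∈ Finset.univ.filter Q, ⋂ i ∈ (Finset.univ : Finset (Fin m)), X i ⁻¹' {w i} := by
    intro ω hω
    simp only [Set.mem_iUnion, Set.mem_iInter]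
    exact ⟨fun i : Fin m => X i ω, by simpa using hω, fun i _ => rfl⟩
  refine (measure_mono hsub).trans ((measure_biUnion_finset_le _ _).trans ?_)
  simp only [hpt, Finset.sum_const, nsmul_eq_mul]
  rw [uniformProb, Finset.sum_boole, Fintype.card_fun, Fintype.card_fin, ENNReal.ofReal_div_of_pos
    (by push_cast; positivity), ENNReal.ofReal_natCast, ENNReal.ofReal_natCast, Nat.cast_pow,
    div_eq_mul_inv, ENNReal.inv_pow]

section Tails

variable {F Ω : Type*} [Field F] [Fintype F] [MeasurableSpace F] [MeasurableSingletonClass F]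
  [MeasurableSpace Ω] {P : Measure Ω} {n : ℕ} {X : ℕ → Ω → (Fin n → F)}

lemma measure_circuitTime_lt_le (hindep : iIndepFun X P)
    (hunif : ∀ i, HasLaw (X i) (uniformOn Set.univ) P) {k : ℕ} (hk : 1 ≤ k) (y : ℝ) :
    P {ω | enatToEReal (circuitTime (fun i => X i ω) k) < (y : EReal)} ≤
      ENNReal.ofReal ((⌊y⌋₊.choose k : ℝ) *
        (((Fintype.card F : ℝ) - 1) ^ (k - 1) / (Fintype.card F : ℝ) ^ n)) := by
  have hV : (Fintype.card (Fin n → F) : ℝ) = (Fintype.card F : ℝ) ^ n := by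
    simp
  have h := uniformProb_exists_isCircuitOn_le (E := Fin ⌊y⌋₊) hV hk
  rw [Fintype.card_fin] at h
  refine (measure_mono fun ω hω => ?_).trans ((measure_le_uniformProb hindep hunif ⌊y⌋₊
    (fun w => ∃ S : Finset (Fin ⌊y⌋₊), S.card = k ∧ IsCircuitOn F w S)).trans
      (ENNReal.ofReal_le_ofReal h))
  exact exists_isCircuitOn_of_circuitTime_lt hω

lemma measure_lt_circuitTime_le (hindep : iIndepFun X P)
    (hunif : ∀ i, HasLaw (X i) (uniformOn Set.univ) P) {k : ℕ} (hk : 1 ≤ k) (hkn : k ≤ n + 1)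
    {θ y : ℝ} (hθ : θ ≤ 1) (hy : 0 ≤ y) (hky : (k : ℝ) ≤ θ * ⌊y⌋₊) :
    P {ω | (y : EReal) < enatToEReal (circuitTime (fun i => X i ω) k)} ≤
      ENNReal.ofReal (4 / ((⌊y⌋₊.choose k : ℝ) *
        (((Fintype.card F : ℝ) - 1) ^ (k - 1) / (Fintype.card F : ℝ) ^ n)) +
        4 * (1 + ((Fintype.card F : ℝ) - 1) * θ) ^ k / (Fintype.card F : ℝ) ^ n) := by
  have hV : (Fintype.card (Fin n → F) : ℝ) = (Fintype.card F : ℝ) ^ n := by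
    simp
  have h := uniformProb_not_exists_isCircuitOn_le (E := Fin ⌊y⌋₊) (θ := θ) hV hk hkn hθ
    (by rwa [Fintype.card_fin])
  rw [Fintype.card_fin] at h
  refine (measure_mono fun ω hω => ?_).trans ((measure_le_uniformProb hindep hunif ⌊y⌋₊
    (fun w => ¬ ∃ S : Finset (Fin ⌊y⌋₊), S.card = k ∧ IsCircuitOn F w S)).trans
      (ENNReal.ofReal_le_ofReal h))
  exact not_exists_isCircuitOn_of_lt_circuitTime hy hω

end Tails

/-! ### Bounds on factorials and binomial coefficients -/

/-- The Stirling sequence decreases from its first value; `√k` is then weakened to `k`, a polynomial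
loss that is harmless against exponential gains. -/
lemma factorial_le_exp_mul {k : ℕ} (hk : 1 ≤ k) :
    (k.factorial : ℝ) ≤ Real.exp 1 * k * (k / Real.exp 1) ^ k := by
  obtain ⟨j, rfl⟩ : ∃ j, k = j + 1 := ⟨k - 1, by omega⟩
  have h : Stirling.stirlingSeq (j + 1) ≤ Stirling.stirlingSeq 1 :=
    Stirling.stirlingSeq'_antitone (Nat.zero_le j)
  rw [Stirling.stirlingSeq_one, Stirling.stirlingSeq, div_le_div_iff₀ (by positivity)
    (by positivity)] at h
  have h2 : (0 : ℝ) < √2 := by positivity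
  rw [Real.sqrt_mul (by norm_num)] at h
  have h3 : √((j + 1 : ℕ) : ℝ) ≤ ((j + 1 : ℕ) : ℝ) := by
    rw [Real.sqrt_le_left (by positivity)]
    have : (1 : ℝ) ≤ ((j + 1 : ℕ) : ℝ) := by push_cast; linarith [(Nat.cast_nonneg j : (0 : ℝ) ≤ j)]
    nlinarith
  have h4 : ((j + 1).factorial : ℝ) ≤
      Real.exp 1 * √((j + 1 : ℕ) : ℝ) * (((j + 1 : ℕ) : ℝ) / Real.exp 1) ^ (j + 1) := by
    refine le_of_mul_le_mul_right (h.trans (le_of_eq ?_)) h2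
    ring
  refine h4.trans ?_
  gcongr

lemma log_factorial_le {k : ℕ} (hk : 1 ≤ k) :
    Real.log k.factorial ≤ k * Real.log k - k + Real.log k + 1 := by
  have hk' : (0 : ℝ) < k := by exact_mod_cast hk
  have h := Real.log_le_log (by exact_mod_cast k.factorial_pos) (factorial_le_exp_mul hk)
  rw [Real.log_mul (by positivity) (by positivity), Real.log_mul (by positivity) (by positivity),
    Real.log_pow, Real.log_div (by positivity) (by positivity), Real.log_exp] at h
  linarith

lemma le_log_factorial {k : ℕ} (hk : 1 ≤ k) :
    k * Real.log k - k ≤ Real.log k.factorial := by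
  have hk' : (1 : ℝ) ≤ k := by exact_mod_cast hk
  have h := Stirling.le_log_factorial_stirling (n := k) (by omega)
  have h1 := Real.log_nonneg hk'
  have h2 : 0 ≤ Real.log (2 * Real.pi) := Real.log_nonneg (by linarith [Real.pi_gt_three])
  linarith

lemma le_log_choose {m k : ℕ} (hk : 1 ≤ k) (hkm : k < m) :
    m * Real.log m - k * Real.log k - ((m - k : ℕ) : ℝ) * Real.log ((m - k : ℕ) : ℝ) -
      (2 * Real.log m + 2) ≤ Real.log (m.choose k) := by
  have h := Nat.choose_mul_factorial_mul_factorial hkm.le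
  have h0 : Real.log (m.choose k) + Real.log k.factorial + Real.log (m - k).factorial =
      Real.log m.factorial := by
    rw [← h]
    push_cast
    have h1 : (m.choose k : ℝ) ≠ 0 := by exact_mod_cast (Nat.choose_pos hkm.le).ne'
    have h2 : (k.factorial : ℝ) ≠ 0 := by exact_mod_cast k.factorial_ne_zero
    have h3 : ((m - k).factorial : ℝ) ≠ 0 := by exact_mod_cast (m - k).factorial_ne_zero
    rw [Real.log_mul (mul_ne_zero h1 h2) h3, Real.log_mul h1 h2]
  have h1 := le_log_factorial (by omega : 1 ≤ m)
  have h2 := log_factorial_le hk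
  have h3 := log_factorial_le (by omega : 1 ≤ m - k)
  have h4 : Real.log k ≤ Real.log m :=
    Real.log_le_log (by exact_mod_cast hk) (by exact_mod_cast hkm.le)
  have h5 : Real.log ((m - k : ℕ) : ℝ) ≤ Real.log m :=
    Real.log_le_log (by exact_mod_cast (by omega : 0 < m - k)) (by exact_mod_cast Nat.sub_le m k)
  have h6 : ((m - k : ℕ) : ℝ) = m - k := Nat.cast_sub hkm.le
  rw [h6] at h3 h5 ⊢
  linarith

/-- One term of the binomial expansion. The free parameter `t` is optimised later to obtain the
sharp exponent in the linear regime. -/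
lemma choose_mul_pow_le {t : ℝ} (ht : 0 ≤ t) (m k : ℕ) :
    (m.choose k : ℝ) * t ^ k ≤ (1 + t) ^ m := by
  rcases le_or_gt k m with h | h
  · rw [add_comm, add_pow]
    have h1 := Finset.single_le_sum (f := fun i => t ^ i * 1 ^ (m - i) * (m.choose i : ℝ))
      (s := Finset.range (m + 1)) (fun i _ => by positivity) (Finset.mem_range.2 (by omega : k < m + 1))
    refine le_trans (le_of_eq ?_) h1
    simp [mul_comm]
  · rw [Nat.choose_eq_zero_of_lt h]
    simp only [Nat.cast_zero, zero_mul]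
    positivity

lemma tendsto_pow_div_pow_zero {q θ : ℝ} (hq : 1 < q) (hθ0 : 0 ≤ θ) (hθ : θ < 1) {k : ℕ → ℕ}
    (hk : ∀ᶠ n in atTop, k n ≤ n + 1) :
    Tendsto (fun n => 4 * (1 + (q - 1) * θ) ^ k n / q ^ n) atTop (𝓝 0) := by
  set r := 1 + (q - 1) * θ with hr
  have hr1 : 1 ≤ r := by nlinarith
  have hrq : r / q < 1 := by
    rw [div_lt_one (by linarith)]
    nlinarith
  have h := (tendsto_pow_atTop_nhds_zero_of_lt_one (by positivity) hrq).const_mul (4 * r)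
  rw [mul_zero] at h
  refine squeeze_zero' (Eventually.of_forall fun n => by positivity) ?_ h
  filter_upwards [hk] with n hn
  calc 4 * r ^ k n / q ^ n ≤ 4 * r ^ (n + 1) / q ^ n := by gcongr
    _ = 4 * r * (r / q) ^ n := by rw [div_pow]; ring

/-! ### The rate function -/

lemma circuitRate_self_neg {q a : ℝ} (hq : 2 ≤ q) (ha : a ≤ 1) : circuitRate q a a < 0 := by
  have h0 : 0 ≤ Real.log (q - 1) := Real.log_nonneg (by linarith)
  have h1 : Real.log (q - 1) < Real.log q := Real.log_lt_log (by linarith) (by linarith)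
  simp only [circuitRate, sub_self, zero_mul]
  nlinarith

lemma continuous_circuitRate (q a : ℝ) : Continuous (circuitRate q a) := by
  have h2 : Continuous fun y : ℝ => (y - a) * Real.log (y - a) :=
    Real.continuous_mul_log.comp (continuous_id.sub continuous_const)
  exact (((Real.continuous_mul_log.add continuous_const).sub continuous_const).sub h2).sub
    continuous_const

lemma strictMonoOn_circuitRate {q a : ℝ} (ha : 0 < a) :
    StrictMonoOn (circuitRate q a) (Set.Ici a) := by
  refine strictMonoOn_of_deriv_pos (convex_Ici a) (continuous_circuitRate q a).continuousOn ?_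
  intro y hy
  rw [interior_Ici, Set.mem_Ioi] at hy
  have h1 : HasDerivAt (fun y : ℝ => y * Real.log y) (Real.log y + 1) y :=
    Real.hasDerivAt_mul_log (by linarith)
  have h2 : HasDerivAt (fun y : ℝ => (y - a) * Real.log (y - a)) (Real.log (y - a) + 1) y := by
    have h := (Real.hasDerivAt_mul_log (x := y - a) (by linarith)).comp_sub_const y a
    exact h
  have h3 : HasDerivAt (circuitRate q a) (Real.log y + 1 - (Real.log (y - a) + 1)) y :=
    (((h1.add_const (a * Real.log (q - 1))).sub_const (a * Real.log a)).sub h2).sub_const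
      (Real.log q)
  rw [h3.deriv]
  have := Real.log_lt_log (by linarith : 0 < y - a) (by linarith : y - a < y)
  linarith

lemma exists_circuitRate_eq_zero {q a : ℝ} (hq : 2 ≤ q) (ha : 0 < a) (ha1 : a ≤ 1) :
    ∃ b, a ≤ b ∧ circuitRate q a b = 0 := by
  -- Chosen so that `a * log (Y / a) = log q`; replacing `log (Y - a)` by `log Y` then bounds the
  -- rate at `Y` below by `a * log (q - 1) ≥ 0`.
  set Y := a * Real.exp (Real.log q / a) with hY
  have hlq : 0 < Real.log q := Real.log_pos (by linarith)
  have haY : a < Y := by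
    have : 1 < Real.exp (Real.log q / a) := Real.one_lt_exp_iff.2 (by positivity)
    nlinarith
  have hlY : a * Real.log Y = a * Real.log a + Real.log q := by
    rw [hY, Real.log_mul ha.ne' (Real.exp_pos _).ne', Real.log_exp, mul_add,
      mul_div_cancel₀ _ ha.ne']
  have h0 : 0 ≤ Real.log (q - 1) := Real.log_nonneg (by linarith)
  have h1 : Real.log (Y - a) ≤ Real.log Y := Real.log_le_log (by linarith) (by linarith)
  have hpos : 0 ≤ circuitRate q a Y := by
    unfold circuitRate
    nlinarith
  obtain ⟨b, hb, hb0⟩ := intermediate_value_Icc haY.le (continuous_circuitRate q a).continuousOn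
    ⟨(circuitRate_self_neg hq ha1).le, hpos⟩
  exact ⟨b, hb.1, hb0⟩

/-! ### Growth of the expected number of circuits -/

/-- Since `m.choose k ≤ m ^ k / k!` and `k ^ k / k! ≤ exp k`, the normalisation of the threshold
cancels everything except `(1 - ε) ^ k`. -/
lemma tendsto_choose_mul_zero_of_sublinear {q ε : ℝ} (hq : 2 ≤ q) (hε : 0 < ε) (hε1 : ε < 1)
    {k : ℕ → ℕ} (hk : Tendsto k atTop atTop) :
    Tendsto (fun n : ℕ => ((⌊(1 - ε) * (1 / (Real.exp 1 * (q - 1)) *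
        ((k n : ℝ) * q ^ ((n : ℝ) / (k n : ℝ))))⌋₊.choose (k n) : ℕ) : ℝ) *
          ((q - 1) ^ (k n - 1) / q ^ n)) atTop (𝓝 0) := by
  have h := (tendsto_pow_atTop_nhds_zero_of_lt_one (by linarith : 0 ≤ 1 - ε)
    (by linarith)).comp hk
  refine squeeze_zero' (Eventually.of_forall fun n => ?_) ?_ h
  · exact mul_nonneg (Nat.cast_nonneg _) (div_nonneg (pow_nonneg (by linarith) _) (by positivity))
  filter_upwards [hk.eventually_ge_atTop 1] with n hn
  set j := k n with hj
  have hj0 : (0 : ℝ) < j := by exact_mod_cast hn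
  have hq1 : 0 < q - 1 := by linarith
  set x := 1 / (Real.exp 1 * (q - 1)) * ((j : ℝ) * q ^ ((n : ℝ) / (j : ℝ))) with hx
  have hx0 : 0 ≤ x := by positivity
  have hxk : x ^ j = (j : ℝ) ^ j * q ^ n / (Real.exp j * (q - 1) ^ j) := by
    rw [hx, mul_pow, mul_pow, div_pow, one_pow, mul_pow, ← Real.exp_nat_mul, mul_one,
      ← Real.rpow_natCast (q ^ ((n : ℝ) / (j : ℝ))) j, ← Real.rpow_mul (by linarith),
      div_mul_cancel₀ _ hj0.ne', Real.rpow_natCast]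
    ring
  have hy0 : 0 ≤ (1 - ε) * x := mul_nonneg (by linarith) hx0
  have h1 : ((⌊(1 - ε) * x⌋₊.choose j : ℕ) : ℝ) ≤ ((1 - ε) * x) ^ j / j.factorial := by
    refine (Nat.choose_le_pow_div j _).trans ?_
    gcongr
    exact Nat.floor_le hy0
  have h2 : (j : ℝ) ^ j / j.factorial ≤ Real.exp j := Real.pow_div_factorial_le_exp j hj0.le j
  have h3 : (q - 1) ^ (j - 1) ≤ (q - 1) ^ j := pow_le_pow_right₀ (by linarith) (by omega)
  calc _ ≤ ((1 - ε) * x) ^ j / j.factorial * ((q - 1) ^ j / q ^ n) := by gcongr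
    _ = (1 - ε) ^ j * ((j : ℝ) ^ j / j.factorial / Real.exp j) := by
        rw [mul_pow, hxk]
        field_simp
    _ ≤ (1 - ε) ^ j * 1 := by
        have : 0 ≤ 1 - ε := by linarith
        gcongr
        exact div_le_one_of_le₀ h2 (Real.exp_pos _).le
    _ = _ := by simp [hj]

lemma tendsto_rpow_div_atTop {q : ℝ} (hq : 1 < q) {k : ℕ → ℕ} (hk : Tendsto k atTop atTop)
    (hkn : (fun n => (k n : ℝ)) =o[atTop] (fun n => (n : ℝ))) :
    Tendsto (fun n : ℕ => q ^ ((n : ℝ) / (k n : ℝ))) atTop atTop := by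
  refine (tendsto_rpow_atTop_of_base_gt_one q hq).comp ?_
  have h := hkn.tendsto_div_nhds_zero
  have h2 : Tendsto (fun n : ℕ => (k n : ℝ) / (n : ℝ)) atTop (𝓝[>] 0) := by
    refine tendsto_nhdsWithin_iff.2 ⟨h, ?_⟩
    filter_upwards [hk.eventually_ge_atTop 1, eventually_ge_atTop 1] with n h1 h2
    have h1' : (0 : ℝ) < k n := by exact_mod_cast h1
    have h2' : (0 : ℝ) < n := by exact_mod_cast h2
    exact div_pos h1' h2'
  refine h2.inv_tendsto_nhdsGT_zero.congr fun n => ?_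
  simp

lemma eventually_le_mul_of_sublinear {q c : ℝ} (hq : 2 ≤ q) (hc : 0 < c) {k : ℕ → ℕ}
    (hk : Tendsto k atTop atTop) (hkn : (fun n => (k n : ℝ)) =o[atTop] (fun n => (n : ℝ))) :
    ∀ᶠ n : ℕ in atTop, (k n : ℝ) ≤
      c * (1 / (Real.exp 1 * (q - 1)) * ((k n : ℝ) * q ^ ((n : ℝ) / (k n : ℝ)))) := by
  have hq1 : 0 < q - 1 := by linarith
  filter_upwards [(tendsto_rpow_div_atTop (by linarith : 1 < q) hk hkn).eventually_ge_atTop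
    (Real.exp 1 * (q - 1) / c)] with n hn
  rw [div_le_iff₀ hc] at hn
  have h1 : 1 ≤ c * (1 / (Real.exp 1 * (q - 1))) * q ^ ((n : ℝ) / (k n : ℝ)) := by
    rw [mul_one_div, div_mul_eq_mul_div, one_le_div (by positivity)]
    linarith
  calc (k n : ℝ) = k n * 1 := by ring
    _ ≤ k n * (c * (1 / (Real.exp 1 * (q - 1))) * q ^ ((n : ℝ) / (k n : ℝ))) := by gcongr
    _ = _ := by ring

lemma pow_div_factorial_le_choose {m k : ℕ} {z : ℝ} (hz : 0 ≤ z) (hk : k ≤ m + 1)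
    (h : z ≤ (m : ℝ) + 1 - k) : z ^ k / k.factorial ≤ (m.choose k : ℝ) := by
  rw [div_le_iff₀ (by exact_mod_cast k.factorial_pos)]
  have h1 : ((m + 1 - k : ℕ) : ℝ) ^ k ≤ (k.factorial : ℝ) * m.choose k := by
    exact_mod_cast Nat.pow_sub_le_descFactorial m k |>.trans_eq
      (Nat.descFactorial_eq_factorial_mul_choose m k)
  have h2 : ((m + 1 - k : ℕ) : ℝ) = (m : ℝ) + 1 - k := by
    rw [Nat.cast_sub hk]
    push_cast
    ring
  rw [h2] at h1
  calc z ^ k ≤ ((m : ℝ) + 1 - k) ^ k := by gcongr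
    _ ≤ _ := h1
    _ = _ := by ring

lemma tendsto_choose_mul_atTop_of_sublinear {q ε : ℝ} (hq : 2 ≤ q) (hε : 0 < ε)
    {k : ℕ → ℕ} (hk : Tendsto k atTop atTop)
    (hkn : (fun n => (k n : ℝ)) =o[atTop] (fun n => (n : ℝ))) :
    Tendsto (fun n : ℕ => ((⌊(1 + ε) * (1 / (Real.exp 1 * (q - 1)) *
        ((k n : ℝ) * q ^ ((n : ℝ) / (k n : ℝ))))⌋₊.choose (k n) : ℕ) : ℝ) *
          ((q - 1) ^ (k n - 1) / q ^ n)) atTop atTop := by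
  have hq1 : 0 < q - 1 := by linarith
  have h0 : Tendsto (fun j : ℕ => ((j : ℝ) ^ 1 / (1 + ε / 2) ^ j)⁻¹) atTop atTop := by
    have h1 : Tendsto (fun j : ℕ => (j : ℝ) ^ 1 / (1 + ε / 2) ^ j) atTop (𝓝[>] 0) := by
      refine tendsto_nhdsWithin_iff.2
        ⟨tendsto_pow_const_div_const_pow_of_one_lt 1 (by linarith), ?_⟩
      filter_upwards [eventually_ge_atTop 1] with j hj
      have : (0 : ℝ) < j := by exact_mod_cast hj
      have h2 : 0 < 1 + ε / 2 := by linarith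
      exact Set.mem_Ioi.2 (div_pos (pow_pos this 1) (pow_pos h2 j))
    exact h1.inv_tendsto_nhdsGT_zero
  have h := (h0.comp hk).const_mul_atTop (by positivity : 0 < 1 / (Real.exp 1 * (q - 1)))
  refine tendsto_atTop_mono' _ ?_ h
  -- Half of `ε` pays for the loss of `k` in `(m + 1 - k) ^ k`, as `k` is negligible against the
  -- threshold. The other half leaves the growth `(1 + ε / 2) ^ k / k`.
  filter_upwards [hk.eventually_ge_atTop 1,
    eventually_le_mul_of_sublinear hq (by positivity : 0 < ε / 2) hk hkn] with n hn hkx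
  set j := k n with hj
  have hj0 : (0 : ℝ) < j := by exact_mod_cast hn
  set x := 1 / (Real.exp 1 * (q - 1)) * ((j : ℝ) * q ^ ((n : ℝ) / (j : ℝ))) with hx
  have hx0 : 0 ≤ x := by positivity
  have hxk : x ^ j = (j : ℝ) ^ j * q ^ n / (Real.exp j * (q - 1) ^ j) := by
    rw [hx, mul_pow, mul_pow, div_pow, one_pow, mul_pow, ← Real.exp_nat_mul, mul_one,
      ← Real.rpow_natCast (q ^ ((n : ℝ) / (j : ℝ))) j, ← Real.rpow_mul (by linarith),
      div_mul_cancel₀ _ hj0.ne', Real.rpow_natCast]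
    ring
  have hfl := Nat.lt_floor_add_one ((1 + ε) * x)
  have hz0 : 0 ≤ (1 + ε / 2) * x := by positivity
  have hz : (1 + ε / 2) * x ≤ (⌊(1 + ε) * x⌋₊ : ℝ) + 1 - j := by linarith
  have hjm : j ≤ ⌊(1 + ε) * x⌋₊ + 1 := by
    have : (j : ℝ) ≤ (⌊(1 + ε) * x⌋₊ : ℝ) + 1 := by linarith
    exact_mod_cast this
  have hch := pow_div_factorial_le_choose hz0 hjm hz
  have hfac := factorial_le_exp_mul hn
  have hexp : Real.exp 1 ^ j = Real.exp j := by rw [← Real.exp_nat_mul, mul_one]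
  have hqj : (q - 1) ^ j = (q - 1) ^ (j - 1) * (q - 1) := by
    rw [← pow_succ, Nat.sub_add_cancel hn]
  calc 1 / (Real.exp 1 * (q - 1)) * ((j : ℝ) ^ 1 / (1 + ε / 2) ^ j)⁻¹
      = ((1 + ε / 2) * x) ^ j / (Real.exp 1 * j * (j / Real.exp 1) ^ j) *
          ((q - 1) ^ (j - 1) / q ^ n) := by
        rw [mul_pow, hxk, hqj, div_pow, hexp]
        field_simp
    _ ≤ ((1 + ε / 2) * x) ^ j / j.factorial * ((q - 1) ^ (j - 1) / q ^ n) := by gcongr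
    _ ≤ _ := by gcongr

lemma tendsto_choose_mul_zero_of_linear {q a y : ℝ} (hq : 2 ≤ q) (ha : 0 < a) (hay : a < y)
    (hneg : circuitRate q a y < 0) {k : ℕ → ℕ}
    (hk : Tendsto (fun n : ℕ => (k n : ℝ) / n) atTop (𝓝 a)) :
    Tendsto (fun n : ℕ => ((⌊y * n⌋₊.choose (k n) : ℕ) : ℝ) * ((q - 1) ^ (k n - 1) / q ^ n))
      atTop (𝓝 0) := by
  have hq1 : 0 < q - 1 := by linarith
  -- The minimiser of `y * log (1 + t) - a * log t`, for which the upper bound has exponent exactly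
  -- `circuitRate q a y`.
  set t := a / (y - a) with ht
  have hya : 0 < y - a := by linarith
  have ht0 : 0 < t := div_pos ha hya
  have h1t : 1 + t = y / (y - a) := by rw [ht]; field_simp; ring
  have hL : Tendsto (fun n : ℕ => y * Real.log (1 + t) +
      (k n : ℝ) / n * (Real.log (q - 1) - Real.log t) - Real.log q) atTop
      (𝓝 (circuitRate q a y)) := by
    have h := ((hk.mul_const (Real.log (q - 1) - Real.log t)).const_add
      (y * Real.log (1 + t))).sub_const (Real.log q)
    convert h using 2
    rw [h1t, ht, Real.log_div (by linarith) hya.ne', Real.log_div ha.ne' hya.ne', circuitRate]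
    ring
  have hE := Real.tendsto_exp_atBot.comp
    (tendsto_natCast_atTop_atTop.atTop_mul_neg hneg hL)
  refine squeeze_zero' (Eventually.of_forall fun n =>
    mul_nonneg (Nat.cast_nonneg _) (div_nonneg (pow_nonneg hq1.le _) (by positivity))) ?_ hE
  filter_upwards [eventually_ge_atTop 1] with n hn
  have hn0 : (0 : ℝ) < n := by exact_mod_cast hn
  have hm : (⌊y * n⌋₊ : ℝ) ≤ y * n := Nat.floor_le (mul_nonneg (by linarith) hn0.le)
  have h1 := choose_mul_pow_le ht0.le ⌊y * n⌋₊ (k n)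
  have hexp : Real.exp (n * (y * Real.log (1 + t) +
      (k n : ℝ) / n * (Real.log (q - 1) - Real.log t) - Real.log q)) =
      (1 + t) ^ (y * n) / t ^ k n * ((q - 1) ^ k n / q ^ n) := by
    have e1 : (1 + t) ^ (y * n) = Real.exp (Real.log (1 + t) * (y * n)) :=
      Real.rpow_def_of_pos (by positivity) _
    have e2 : ∀ z : ℝ, 0 < z → ∀ i : ℕ, z ^ i = Real.exp (i * Real.log z) := by
      intro z hz i
      rw [Real.exp_nat_mul, Real.exp_log hz]
    rw [e1, e2 t ht0, e2 _ hq1, e2 q (by linarith), ← Real.exp_sub, ← Real.exp_sub, ← Real.exp_add]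
    congr 1
    field_simp
    ring
  simp only [Function.comp]
  rw [hexp]
  have h2 : ((⌊y * n⌋₊.choose (k n) : ℕ) : ℝ) ≤ (1 + t) ^ (y * n) / t ^ k n := by
    rw [le_div_iff₀ (by positivity)]
    refine h1.trans ?_
    rw [← Real.rpow_natCast]
    exact Real.rpow_le_rpow_of_exponent_le (by linarith) hm
  have h3 : (q - 1) ^ (k n - 1) ≤ (q - 1) ^ k n := pow_le_pow_right₀ (by linarith) (by omega)
  gcongr

lemma tendsto_floor_mul_div {y : ℝ} (hy : 0 ≤ y) :
    Tendsto (fun n : ℕ => (⌊y * n⌋₊ : ℝ) / n) atTop (𝓝 y) :=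
  (tendsto_nat_floor_mul_div_atTop hy).comp tendsto_natCast_atTop_atTop

lemma tendsto_choose_mul_atTop_of_linear {q a y : ℝ} (hq : 2 ≤ q) (ha : 0 < a) (hay : a < y)
    (hpos : 0 < circuitRate q a y) {k : ℕ → ℕ}
    (hk : Tendsto (fun n : ℕ => (k n : ℝ) / n) atTop (𝓝 a)) :
    Tendsto (fun n : ℕ => ((⌊y * n⌋₊.choose (k n) : ℕ) : ℝ) * ((q - 1) ^ (k n - 1) / q ^ n))
      atTop atTop := by
  have hq1 : 0 < q - 1 := by linarith
  have hy0 : 0 < y := by linarith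
  set φ : ℝ → ℝ := fun x => x * Real.log x with hφ
  have hφc : Continuous φ := Real.continuous_mul_log
  have hM := tendsto_floor_mul_div hy0.le
  have hlog : Tendsto (fun n : ℕ => Real.log ⌊y * n⌋₊ / n) atTop (𝓝 0) := by
    have hm : Tendsto (fun n : ℕ => y * (n : ℝ)) atTop atTop :=
      tendsto_natCast_atTop_atTop.const_mul_atTop hy0
    have h1 : Tendsto (fun n : ℕ => Real.log ⌊y * n⌋₊ / (⌊y * n⌋₊ : ℝ)) atTop (𝓝 0) :=
      (Real.isLittleO_log_id_atTop.tendsto_div_nhds_zero).comp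
        (tendsto_natCast_atTop_atTop.comp (tendsto_nat_floor_atTop.comp hm))
    have h2 := h1.mul hM
    rw [zero_mul] at h2
    refine h2.congr' ?_
    filter_upwards [hm.eventually_ge_atTop 1] with n hn
    have : (0 : ℝ) < ⌊y * n⌋₊ := by exact_mod_cast Nat.floor_pos.2 hn
    field_simp
  have hinv : Tendsto (fun n : ℕ => 1 / (n : ℝ)) atTop (𝓝 0) := tendsto_one_div_atTop_nhds_zero_nat
  have hL : Tendsto (fun n : ℕ => φ ((⌊y * n⌋₊ : ℝ) / n) - φ ((k n : ℝ) / n) -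
      φ ((⌊y * n⌋₊ : ℝ) / n - (k n : ℝ) / n) - (2 * (Real.log ⌊y * n⌋₊ / n) + 2 * (1 / (n : ℝ))) +
      ((k n : ℝ) / n - 1 / n) * Real.log (q - 1) - Real.log q) atTop (𝓝 (circuitRate q a y)) := by
    have h := ((((((hφc.tendsto y).comp hM).sub ((hφc.tendsto a).comp hk)).sub
      ((hφc.tendsto (y - a)).comp (hM.sub hk))).sub
      ((hlog.const_mul 2).add (hinv.const_mul 2))).add
      ((hk.sub hinv).mul_const (Real.log (q - 1)))).sub_const (Real.log q)
    have e : φ y - φ a - φ (y - a) - (2 * 0 + 2 * 0) + (a - 0) * Real.log (q - 1) - Real.log q =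
        circuitRate q a y := by
      simp only [circuitRate, hφ]
      ring
    rw [e] at h
    exact h
  have hE := Real.tendsto_exp_atTop.comp
    (tendsto_natCast_atTop_atTop.atTop_mul_pos hpos hL)
  refine tendsto_atTop_mono' _ ?_ hE
  filter_upwards [eventually_ge_atTop 1, hk.eventually_lt hM hay, hk.eventually_const_lt ha]
    with n hn hlt hkpos
  have hn0 : (0 : ℝ) < n := by exact_mod_cast hn
  set m := ⌊y * n⌋₊ with hm
  set j := k n with hj
  have hjm : j < m := by
    rw [div_lt_div_iff_of_pos_right hn0] at hlt
    exact_mod_cast hlt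
  have hj1 : 1 ≤ j := by
    have : (0 : ℝ) < j := (div_pos_iff_of_pos_right hn0).1 hkpos
    exact_mod_cast this
  have hj0 : (0 : ℝ) < j := by exact_mod_cast hj1
  have hmj : ((m - j : ℕ) : ℝ) = m - j := Nat.cast_sub hjm.le
  have hmj0 : (0 : ℝ) < (m : ℝ) - j := by
    have : (j : ℝ) < m := by exact_mod_cast hjm
    linarith
  have hm0 : (0 : ℝ) < m := by linarith
  have hch := le_log_choose hj1 hjm
  rw [hmj] at hch
  have hchpos : (0 : ℝ) < m.choose j := by exact_mod_cast Nat.choose_pos hjm.le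
  have hval : Real.log ((m.choose j : ℝ) * ((q - 1) ^ (j - 1) / q ^ n)) =
      Real.log (m.choose j) + ((j : ℝ) - 1) * Real.log (q - 1) - n * Real.log q := by
    rw [Real.log_mul hchpos.ne' (by positivity), Real.log_div (by positivity) (by positivity),
      Real.log_pow, Real.log_pow, Nat.cast_sub hj1]
    push_cast
    ring
  -- Rescaling by `n` is exact: the `log n` contributions carry total weight `m - j - (m - j) = 0`.
  have hfin : (n : ℝ) * (φ ((m : ℝ) / n) - φ ((j : ℝ) / n) -
      φ ((m : ℝ) / n - (j : ℝ) / n) - (2 * (Real.log m / n) + 2 * (1 / (n : ℝ))) +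
      ((j : ℝ) / n - 1 / n) * Real.log (q - 1) - Real.log q) =
      m * Real.log m - j * Real.log j - (m - j) * Real.log (m - j) - (2 * Real.log m + 2) +
      ((j : ℝ) - 1) * Real.log (q - 1) - n * Real.log q := by
    simp only [hφ]
    rw [← sub_div, Real.log_div hm0.ne' hn0.ne', Real.log_div hj0.ne' hn0.ne',
      Real.log_div hmj0.ne' hn0.ne']
    field_simp
    ring
  simp only [Function.comp]
  rw [hfin, ← Real.le_log_iff_exp_le (by positivity), hval]
  linarith

/-! ### Convergence in probability from tail bounds -/

lemma isAasEquivalent_of_tails {Ω : ℕ → Type*} [∀ n, MeasurableSpace (Ω n)]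
    {P : ∀ n, Measure (Ω n)} [∀ n, IsProbabilityMeasure (P n)] {X : ∀ n, Ω n → ℕ∞} {x : ℕ → ℝ}
    {ε₀ : ℝ} (hε₀ : 0 < ε₀) (hx : ∀ n, 0 ≤ x n)
    (hlow : ∀ ε, 0 < ε → ε < ε₀ → Tendsto (fun n =>
      P n {ω | enatToEReal (X n ω) < (((1 - ε) * x n : ℝ) : EReal)}) atTop (𝓝 0))
    (hupp : ∀ ε, 0 < ε → ε < ε₀ → Tendsto (fun n =>
      P n {ω | (((1 + ε) * x n : ℝ) : EReal) < enatToEReal (X n ω)}) atTop (𝓝 0)) :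
    IsAasEquivalent P X x := by
  intro ε hε
  -- A narrower window lies inside the wider one, so tail bounds for small `ε` suffice.
  set δ := min ε (ε₀ / 2) with hδ
  have hδ0 : 0 < δ := lt_min hε (by linarith)
  have hδε : δ ≤ ε := min_le_left _ _
  have hδ1 : δ < ε₀ := (min_le_right _ _).trans_lt (by linarith)
  have hsum := (hlow δ hδ0 hδ1).add (hupp δ hδ0 hδ1)
  rw [add_zero] at hsum
  have hsub := ENNReal.Tendsto.sub (tendsto_const_nhds (x := (1 : ENNReal))) hsum
    (Or.inl ENNReal.one_ne_top)
  rw [tsub_zero] at hsub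
  refine tendsto_of_tendsto_of_tendsto_of_le_of_le hsub tendsto_const_nhds (fun n => ?_)
    (fun n => prob_le_one)
  rw [tsub_le_iff_right]
  calc (1 : ENNReal) = P n Set.univ := measure_univ.symm
    _ ≤ P n ({ω | (((1 - ε) * x n : ℝ) : EReal) ≤ enatToEReal (X n ω) ∧
        enatToEReal (X n ω) ≤ (((1 + ε) * x n : ℝ) : EReal)} ∪
        ({ω | enatToEReal (X n ω) < (((1 - δ) * x n : ℝ) : EReal)} ∪
        {ω | (((1 + δ) * x n : ℝ) : EReal) < enatToEReal (X n ω)})) := by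
      refine measure_mono fun ω _ => ?_
      by_cases h1 : enatToEReal (X n ω) < (((1 - δ) * x n : ℝ) : EReal)
      · exact Or.inr (Or.inl h1)
      by_cases h2 : (((1 + δ) * x n : ℝ) : EReal) < enatToEReal (X n ω)
      · exact Or.inr (Or.inr h2)
      push Not at h1 h2
      refine Or.inl ⟨le_trans ?_ h1, le_trans h2 ?_⟩
      · rw [EReal.coe_le_coe_iff]
        exact mul_le_mul_of_nonneg_right (by linarith) (hx n)
      · rw [EReal.coe_le_coe_iff]
        exact mul_le_mul_of_nonneg_right (by linarith) (hx n)
    _ ≤ _ := (measure_union_le _ _).trans (add_le_add le_rfl (measure_union_le _ _))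

section Families

variable {F : Type*} [Field F] [Fintype F] [MeasurableSpace F] [MeasurableSingletonClass F]
  {Ω : ℕ → Type*} [∀ n, MeasurableSpace (Ω n)] {P : ∀ n, Measure (Ω n)}
  {v : ∀ n, ℕ → Ω n → (Fin n → F)}

/-- The circuit time is concentrated around `x` as soon as the expected number of circuits tends
to `0` slightly below `x` and to infinity slightly above `x`. -/
lemma isAasEquivalent_circuitTime [∀ n, IsProbabilityMeasure (P n)]
    (hindep : ∀ n, iIndepFun (v n) (P n))
    (hunif : ∀ n i, HasLaw (v n i) (uniformOn Set.univ) (P n)) {k : ℕ → ℕ} {x : ℕ → ℝ} {ε₀ : ℝ}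
    (hε₀ : 0 < ε₀) (hx : ∀ n, 0 ≤ x n) (hk : ∀ᶠ n in atTop, 1 ≤ k n)
    (hkn : ∀ᶠ n in atTop, k n ≤ n + 1)
    (hlow : ∀ ε, 0 < ε → ε < ε₀ → Tendsto (fun n => ((⌊(1 - ε) * x n⌋₊.choose (k n) : ℕ) : ℝ) *
      (((Fintype.card F : ℝ) - 1) ^ (k n - 1) / (Fintype.card F : ℝ) ^ n)) atTop (𝓝 0))
    (hupp : ∀ ε, 0 < ε → ε < ε₀ → Tendsto (fun n => ((⌊(1 + ε) * x n⌋₊.choose (k n) : ℕ) : ℝ) *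
      (((Fintype.card F : ℝ) - 1) ^ (k n - 1) / (Fintype.card F : ℝ) ^ n)) atTop atTop)
    (hθ : ∀ ε, 0 < ε → ε < ε₀ → ∃ θ : ℝ, 0 ≤ θ ∧ θ < 1 ∧
      ∀ᶠ n in atTop, (k n : ℝ) ≤ θ * ⌊(1 + ε) * x n⌋₊) :
    IsAasEquivalent P (fun n ω => circuitTime (fun i => v n i ω) (k n)) x := by
  have hq := two_le_card_field F
  refine isAasEquivalent_of_tails hε₀ hx (fun ε hε hε1 => ?_) (fun ε hε hε1 => ?_)
  · have h := ENNReal.tendsto_ofReal (hlow ε hε hε1)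
    rw [ENNReal.ofReal_zero] at h
    refine tendsto_of_tendsto_of_tendsto_of_le_of_le' tendsto_const_nhds h
      (Eventually.of_forall fun n => zero_le) ?_
    filter_upwards [hk] with n hn
    exact measure_circuitTime_lt_le (hindep n) (hunif n) hn _
  · obtain ⟨θ, hθ0, hθ1, hθk⟩ := hθ ε hε hε1
    have h := ENNReal.tendsto_ofReal (((hupp ε hε hε1).const_div_atTop 4).add
      (tendsto_pow_div_pow_zero (by linarith : 1 < (Fintype.card F : ℝ)) hθ0 hθ1 hkn))
    rw [add_zero, ENNReal.ofReal_zero] at h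
    refine tendsto_of_tendsto_of_tendsto_of_le_of_le' tendsto_const_nhds h
      (Eventually.of_forall fun n => zero_le) ?_
    filter_upwards [hk, hkn, hθk] with n hn hn' hn''
    exact measure_lt_circuitTime_le (hindep n) (hunif n) hn hn' hθ1.le
      (mul_nonneg (by linarith) (hx n)) hn''

lemma measure_add_measure_le_of_fixed
    (hindep : ∀ n, iIndepFun (v n) (P n))
    (hunif : ∀ n i, HasLaw (v n i) (uniformOn Set.univ) (P n)) {k : ℕ} (hk : 1 ≤ k) {ε : ℝ}
    (hε : 0 < ε) : ∀ᶠ n : ℕ in atTop,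
      P n {ω | enatToEReal (circuitTime (fun i => v n i ω) k) <
        ((ε * (Fintype.card F : ℝ) ^ ((n : ℝ) / (k : ℝ)) : ℝ) : EReal)} +
      P n {ω | ((ε⁻¹ * (Fintype.card F : ℝ) ^ ((n : ℝ) / (k : ℝ)) : ℝ) : EReal) <
        enatToEReal (circuitTime (fun i => v n i ω) k)} ≤
      ENNReal.ofReal ((((Fintype.card F : ℝ) - 1) ^ (k - 1) + 4 * (2 ^ k * k.factorial) + 1) *
        ε ^ k) := by
  have hq := two_le_card_field F
  set q : ℝ := (Fintype.card F : ℝ) with hqdef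
  have hk0 : (0 : ℝ) < k := by exact_mod_cast hk
  have hkn : ∀ᶠ n : ℕ in atTop, k ≤ n + 1 := by
    filter_upwards [eventually_ge_atTop k] with n hn
    omega
  have hpow : ∀ n : ℕ, (q ^ ((n : ℝ) / (k : ℝ))) ^ k = q ^ n := by
    intro n
    rw [← Real.rpow_natCast (q ^ ((n : ℝ) / (k : ℝ))) k, ← Real.rpow_mul (by linarith),
      div_mul_cancel₀ _ hk0.ne', Real.rpow_natCast]
  have hlarge : Tendsto (fun n : ℕ => ε⁻¹ * q ^ ((n : ℝ) / (k : ℝ))) atTop atTop := by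
    refine Tendsto.const_mul_atTop (by positivity) ?_
    refine (tendsto_rpow_atTop_of_base_gt_one q (by linarith)).comp ?_
    exact tendsto_natCast_atTop_atTop.atTop_div_const hk0
  have hB := tendsto_pow_div_pow_zero (by linarith : 1 < q) (by norm_num : (0 : ℝ) ≤ 1 / 2)
    (by norm_num) hkn
  -- The size `2 * k + 1` ensures, after rounding down, both `k ≤ m / 2` and `ε⁻¹ * x / 2 ≤ m + 1 -
  -- k`. The overlap term tends to 0, so it is eventually below `ε ^ k`, which accounts for the `+
  -- 1` in the constant.
  filter_upwards [hkn, hlarge.eventually_ge_atTop (2 * k + 1),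
    hB.eventually_le_const (pow_pos hε k)] with n hn hn' hBn
  set x := q ^ ((n : ℝ) / (k : ℝ)) with hx
  have hx0 : 0 < x := Real.rpow_pos_of_pos (by linarith) _
  have hqn : 0 < q ^ n := by positivity
  have hq1 : 0 ≤ q - 1 := by linarith
  have hfl := Nat.lt_floor_add_one (ε⁻¹ * x)
  have h1 : P n {ω | enatToEReal (circuitTime (fun i => v n i ω) k) < ((ε * x : ℝ) : EReal)} ≤
      ENNReal.ofReal ((q - 1) ^ (k - 1) * ε ^ k) := by
    refine (measure_circuitTime_lt_le (hindep n) (hunif n) hk _).trans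
      (ENNReal.ofReal_le_ofReal ?_)
    have hch : ((⌊ε * x⌋₊.choose k : ℕ) : ℝ) ≤ (ε * x) ^ k := by
      calc ((⌊ε * x⌋₊.choose k : ℕ) : ℝ) ≤ (⌊ε * x⌋₊ : ℝ) ^ k := by
            exact_mod_cast Nat.choose_le_pow _ _
        _ ≤ (ε * x) ^ k := by
            gcongr
            exact Nat.floor_le (by positivity)
    rw [mul_pow, hpow] at hch
    calc _ ≤ ε ^ k * q ^ n * ((q - 1) ^ (k - 1) / q ^ n) := by
          refine mul_le_mul_of_nonneg_right hch (div_nonneg (pow_nonneg hq1 _) hqn.le)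
      _ = _ := by field_simp
  have h2 : P n {ω | ((ε⁻¹ * x : ℝ) : EReal) < enatToEReal (circuitTime (fun i => v n i ω) k)} ≤
      ENNReal.ofReal (4 * (2 ^ k * k.factorial) * ε ^ k + ε ^ k) := by
    refine (measure_lt_circuitTime_le (hindep n) (hunif n) hk hn (θ := 1 / 2) (by norm_num)
      (by positivity) (by linarith)).trans (ENNReal.ofReal_le_ofReal (add_le_add ?_ hBn))
    have hkm : k ≤ ⌊ε⁻¹ * x⌋₊ + 1 := by
      have : (k : ℝ) ≤ (⌊ε⁻¹ * x⌋₊ : ℝ) + 1 := by linarith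
      exact_mod_cast this
    have hch := pow_div_factorial_le_choose (z := ε⁻¹ * x / 2) (by positivity) hkm (by linarith)
    have hone : 1 ≤ (q - 1) ^ (k - 1) := one_le_pow₀ (by linarith)
    have hlow : (ε ^ k)⁻¹ / (2 ^ k * k.factorial) ≤
        ((⌊ε⁻¹ * x⌋₊.choose k : ℕ) : ℝ) * ((q - 1) ^ (k - 1) / q ^ n) := by
      calc (ε ^ k)⁻¹ / (2 ^ k * k.factorial)
          = (ε⁻¹ * x / 2) ^ k / k.factorial * (1 / q ^ n) := by
            rw [div_pow, mul_pow, hpow, inv_pow]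
            field_simp
        _ ≤ _ := by gcongr
    have hpos : 0 < (ε ^ k)⁻¹ / (2 ^ k * k.factorial) := by positivity
    calc _ ≤ 4 / ((ε ^ k)⁻¹ / (2 ^ k * k.factorial)) := by gcongr
      _ = _ := by field_simp
  refine (add_le_add h1 h2).trans ?_
  rw [← ENNReal.ofReal_add (mul_nonneg (pow_nonneg hq1 _) (by positivity)) (by positivity)]
  refine ENNReal.ofReal_le_ofReal (le_of_eq ?_)
  ring

lemma isThetaInProbability_circuitTime
    (hindep : ∀ n, iIndepFun (v n) (P n))
    (hunif : ∀ n i, HasLaw (v n i) (uniformOn Set.univ) (P n)) {k : ℕ} (hk : 1 ≤ k) :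
    IsThetaInProbability P (fun n ω => circuitTime (fun i => v n i ω) k)
      (fun n => (Fintype.card F : ℝ) ^ ((n : ℝ) / (k : ℝ))) := by
  have hc : Continuous fun ε : ℝ => ENNReal.ofReal
      ((((Fintype.card F : ℝ) - 1) ^ (k - 1) + 4 * (2 ^ k * k.factorial) + 1) * ε ^ k) :=
    ENNReal.continuous_ofReal.comp (by fun_prop)
  have h := hc.tendsto 0
  rw [zero_pow (by omega), mul_zero, ENNReal.ofReal_zero] at h
  refine tendsto_of_tendsto_of_tendsto_of_le_of_le' tendsto_const_nhds
    (h.mono_left nhdsWithin_le_nhds) (Eventually.of_forall fun ε => zero_le) ?_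
  filter_upwards [self_mem_nhdsWithin] with ε hε
  -- For each `ε` the bound is free of `n`, so it passes to the limsup before `ε` tends to 0.
  exact limsup_le_of_le (h := measure_add_measure_le_of_fixed hindep hunif hk hε)

lemma isAasEquivalent_circuitTime_of_sublinear [∀ n, IsProbabilityMeasure (P n)]
    (hindep : ∀ n, iIndepFun (v n) (P n))
    (hunif : ∀ n i, HasLaw (v n i) (uniformOn Set.univ) (P n)) {k : ℕ → ℕ}
    (hk : Tendsto k atTop atTop) (hkn : (fun n => (k n : ℝ)) =o[atTop] (fun n => (n : ℝ))) :
    IsAasEquivalent P (fun n ω => circuitTime (fun i => v n i ω) (k n))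
      (fun n => 1 / (Real.exp 1 * ((Fintype.card F : ℝ) - 1)) *
        ((k n : ℝ) * (Fintype.card F : ℝ) ^ ((n : ℝ) / (k n : ℝ)))) := by
  have hq := two_le_card_field F
  have hle : ∀ᶠ n in atTop, k n ≤ n + 1 := by
    filter_upwards [hkn.bound (c := 1) one_pos] with n hn
    have : (k n : ℝ) ≤ n := by simpa using hn
    have : k n ≤ n := by exact_mod_cast this
    omega
  refine isAasEquivalent_circuitTime hindep hunif one_pos (fun n => ?_)
    (hk.eventually_ge_atTop 1) hle
    (fun ε hε hε1 => tendsto_choose_mul_zero_of_sublinear hq hε hε1 hk)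
    (fun ε hε _ => tendsto_choose_mul_atTop_of_sublinear hq hε hk hkn) (fun ε hε _ => ?_)
  · have : 0 ≤ (Fintype.card F : ℝ) - 1 := by linarith
    positivity
  · refine ⟨1 / 2, by norm_num, by norm_num, ?_⟩
    -- From `4 * k ≤ x`, the floor is at least `4 * k - 1`, hence at least `2 * k` because `k ≥ 1`.
    filter_upwards [eventually_le_mul_of_sublinear hq (by norm_num : (0 : ℝ) < 1 / 4) hk hkn,
      hk.eventually_ge_atTop 1] with n hn hk1
    set x := 1 / (Real.exp 1 * ((Fintype.card F : ℝ) - 1)) *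
        ((k n : ℝ) * (Fintype.card F : ℝ) ^ ((n : ℝ) / (k n : ℝ)))
    have hk1' : (1 : ℝ) ≤ k n := by exact_mod_cast hk1
    have := Nat.lt_floor_add_one ((1 + ε) * x)
    nlinarith

lemma isAasEquivalent_circuitTime_of_linear [∀ n, IsProbabilityMeasure (P n)]
    (hindep : ∀ n, iIndepFun (v n) (P n))
    (hunif : ∀ n i, HasLaw (v n i) (uniformOn Set.univ) (P n)) {a b : ℝ} (ha : 0 < a)
    (hab : a < b) (hb : circuitRate (Fintype.card F) a b = 0) {k : ℕ → ℕ}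
    (hk : (fun n => (k n : ℝ)) ~[atTop] (fun n => a * (n : ℝ)))
    (hkn : ∀ᶠ n in atTop, k n ≤ n + 1) :
    IsAasEquivalent P (fun n ω => circuitTime (fun i => v n i ω) (k n))
      (fun n => b * (n : ℝ)) := by
  have hq := two_le_card_field F
  have hb0 : 0 < b := ha.trans hab
  have hmono := strictMonoOn_circuitRate (q := (Fintype.card F : ℝ)) ha
  have hkdiv : Tendsto (fun n : ℕ => (k n : ℝ) / n) atTop (𝓝 a) := by
    have h1 := ((isEquivalent_iff_tendsto_one (by
      filter_upwards [eventually_ge_atTop 1] with n hn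
      have : (0 : ℝ) < n := by exact_mod_cast hn
      positivity)).1 hk).const_mul a
    rw [mul_one] at h1
    refine h1.congr' ?_
    filter_upwards [eventually_ge_atTop 1] with n hn
    have : (0 : ℝ) < n := by exact_mod_cast hn
    simp only [Pi.div_apply]
    field_simp
  have hk1 : ∀ᶠ n in atTop, 1 ≤ k n := by
    filter_upwards [hkdiv.eventually_const_lt ha] with n hn
    by_contra h
    have : k n = 0 := by omega
    simp [this] at hn
  -- For `ε` below this value `(1 - ε) * b` stays above `a`, where the rate is strictly monotone and
  -- the upper estimate applies.
  have hε₀ : 0 < 1 - a / b := by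
    rw [sub_pos, div_lt_one hb0]
    exact hab
  refine isAasEquivalent_circuitTime hindep hunif hε₀ (fun n => by positivity) hk1 hkn
    (fun ε hε hε1 => ?_) (fun ε hε _ => ?_) (fun ε hε _ => ?_)
  · have hay : a < (1 - ε) * b := by
      rw [← div_lt_iff₀ hb0]
      linarith
    have hyb : (1 - ε) * b < b := by nlinarith
    simp only [← mul_assoc]
    exact tendsto_choose_mul_zero_of_linear hq ha hay
      (hb ▸ hmono (Set.mem_Ici.2 hay.le) (Set.mem_Ici.2 hab.le) hyb) hkdiv
  · have hyb : b < (1 + ε) * b := by nlinarith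
    simp only [← mul_assoc]
    exact tendsto_choose_mul_atTop_of_linear hq ha (hab.trans hyb)
      (hb ▸ hmono (Set.mem_Ici.2 hab.le) (Set.mem_Ici.2 (hab.trans hyb).le) hyb) hkdiv
  · have hyb : b < (1 + ε) * b := by nlinarith
    have hy0 : 0 < (1 + ε) * b := hb0.trans hyb
    -- The ratio of `k` to the number of columns tends to `a / ((1 + ε) * b) < 1`, so any `θ`
    -- strictly in between works eventually.
    obtain ⟨θ, hθ1, hθ2⟩ := exists_between ((div_lt_one hy0).2 (hab.trans hyb))
    refine ⟨θ, (div_pos ha hy0).le.trans hθ1.le, hθ2, ?_⟩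
    have hlim := (tendsto_floor_mul_div hy0.le).const_mul θ
    filter_upwards [hkdiv.eventually_lt hlim ((div_lt_iff₀ hy0).1 hθ1), eventually_ge_atTop 1]
      with n hn hn1
    have hn0 : (0 : ℝ) < n := by exact_mod_cast hn1
    rw [← mul_div_assoc, div_lt_div_iff_of_pos_right hn0] at hn
    rw [← mul_assoc]
    exact hn.le

end Families

theorem mainTheorem6 {F : Type*} [Field F] [Fintype F]
    [MeasurableSpace F] [MeasurableSingletonClass F]
    (q : ℕ) (hq : q = Fintype.card F)
    {Ω : ℕ → Type*} [∀ n, MeasurableSpace (Ω n)]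
    (P : ∀ n, Measure (Ω n)) [∀ n, IsProbabilityMeasure (P n)]
    (v : ∀ n, ℕ → Ω n → (Fin n → F))
    (hmeas : ∀ n i, Measurable (v n i))
    (hindep : ∀ n, iIndepFun (v n) (P n))
    (hunif : ∀ n i, HasLaw (v n i) (uniformOn Set.univ) (P n)) :
    -- (a) fixed length
    (∀ k : ℕ, 1 ≤ k →
      IsThetaInProbability P (fun n ω => circuitTime (fun i => v n i ω) k)
        (fun n => (q : ℝ) ^ ((n : ℝ) / (k : ℝ)))) ∧
    -- (b) growing sublinear length
    (∀ k : ℕ → ℕ, Tendsto k atTop atTop →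
      (fun n => (k n : ℝ)) =o[atTop] (fun n => (n : ℝ)) →
      IsAasEquivalent P (fun n ω => circuitTime (fun i => v n i ω) (k n))
        (fun n => 1 / (Real.exp 1 * ((q : ℝ) - 1)) *
          ((k n : ℝ) * (q : ℝ) ^ ((n : ℝ) / (k n : ℝ))))) ∧
    -- (c) linear length
    (∀ a : ℝ, 0 < a → a ≤ 1 →
      ∃ b : ℝ, (a ≤ b ∧ circuitRate q a b = 0 ∧
          ∀ y : ℝ, a ≤ y → circuitRate q a y = 0 → y = b) ∧
        ∀ k : ℕ → ℕ, (fun n => (k n : ℝ)) ~[atTop] (fun n => a * (n : ℝ)) →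
          (∀ᶠ n in atTop, k n ≤ n + 1) →
          IsAasEquivalent P (fun n ω => circuitTime (fun i => v n i ω) (k n))
            (fun n => b * (n : ℝ))) := by
  subst hq
  have hq := two_le_card_field F
  refine ⟨fun k hk => isThetaInProbability_circuitTime hindep hunif hk,
    fun k hk hkn => isAasEquivalent_circuitTime_of_sublinear hindep hunif hk hkn,
    fun a ha ha1 => ?_⟩
  obtain ⟨b, hab, hb⟩ := exists_circuitRate_eq_zero hq ha ha1
  -- The rate at `a` is `a * log (q - 1) - log q < 0`, so the root lies strictly to the right of
  -- `a`.
  have hne : a ≠ b := by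
    rintro rfl
    exact (circuitRate_self_neg hq ha1).ne hb
  refine ⟨b, ⟨hab, hb, fun y hy hy0 => ?_⟩, fun k hk hkn =>
    isAasEquivalent_circuitTime_of_linear hindep hunif ha (lt_of_le_of_ne hab hne) hb hk hkn⟩
  exact (strictMonoOn_circuitRate ha).injOn hy hab (hy0.trans hb.symm)
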